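/- Let $k$ be a field of characteristic zero, $A$ an associative unital $k$-algebra and $\phi:A\to k$ a linear form with $\phi(1_A)=1$. Let $T(A)=\bigoplus_{n>0}A^{\otimes n}$, with tensors written as words $a_1\cdots a_n$, and let $H=\overline T(T(A))=\bigoplus_{m\ge 0}T(A)^{\otimes m}$, with unit $\mathbf 1$, concatenation product $w_1|\cdots|w_m$, counit $\epsilon$ (the projection onto $k\mathbf 1$) and $H^+=\ker\epsilon$. For $S\subseteq[n]$ let $a_S$ be the subword of $a_1\cdots a_n$ with positions in $S$ (with $a_\emptyset=\mathbf 1$) and let $J_1,\dots,J_l$ be the maximal intervals of $[n]\setminus S$, in increasing order. The coproduct $\Delta:H\to H\otimes H$ is the algebra morphism with $\Delta(a_1\cdots a_n)=\sum_{S\subseteq[n]}a_S\otimes a_{J_1}|\cdots|a_{J_l}$. The linear maps $\Delta_\prec^+,\Delta_\succ^+$ on $H^+$ are given on words by the parts of this sum with $1\in S$, respectively $1\notin S$, and by $\Delta^+_{\prec}(w|b)=\Delta^+_{\prec}(w)\cdot\Delta(b)$ and $\Delta^+_{\succ}(w|b)=\Delta^+_{\succ}(w)\cdot\Delta(b)$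 for $w\in T(A)$, $b\in H$. For linear forms $f,g:H\to k$ put $f*g=m_k(f\otimes g)\Delta$; let $f\prec g$ and $f\succ g$ be $m_k(f\otimes g)\Delta^+_\prec$ and $m_k(f\otimes g)\Delta^+_\succ$ on $H^+$ and $0$ on $\mathbf 1$; and put $f\rhd g=f\succ g-g\prec f$, $L_{f\rhd}(g)=f\rhd g$. For $f$ with $f(\mathbf 1)=0$ set $$\exp^*(f)=\sum_{n\ge0}\tfrac1{n!}f^{*n},\qquad \exp^\prec(f)=\sum_{n\ge0}f^{\prec n},\qquad \exp^\succ(f)=\sum_{n\ge0}f^{\succ n},\qquad W(f)=\sum_{n\ge0}\tfrac1{(n+1)!}L_{f\rhd}^n(f),$$ where $f^{*0}=f^{\prec0}=f^{\succ0}=\epsilon$, $f^{*(n+1)}=f*f^{*n}$, $f^{\prec(n+1)}=f\prec f^{\prec n}$ and $f^{\succ(n+1)}=f^{\succ n}\succ f$; let the pre-Lie Magnus expansion $\Omega'(f)$ be the solution $\omega$, with $\omega(\mathbf 1)=0$, of $\omega=\sum_{m\ge0}\frac{B_m}{m!}L_{\omega\rhd}^m(f)$, where $B_m$ are the Bernoulli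 numbers with $B_1=-\frac12$. Let $\Phi:H\to k$ be the character (unital algebra morphism) with $\Phi(a_1\cdots a_n)=\phi(a_1\cdot_A\cdots\cdot_A a_n)$. An infinitesimal character is a linear form on $H$ that vanishes on $\mathbf 1$ and on all products of two elements of $H^+$. Then, for every linear form $f$ on $H$ with $f(\mathbf 1)=0$, each of the four series above has only finitely many non-zero terms on each element of $H$; so has the series in the equation of $\omega=\Omega'(f)$, which exists and is unique; and $W(\Omega'(f))=f=\Omega'(W(f))$. Moreover there are a unique infinitesimal character $\kappa$ with $\Phi=\epsilon+\kappa\prec\Phi$ (free cumulants), a unique infinitesimal character $\beta$ with $\Phi=\epsilon+\Phi\succ\beta$ (boolean cumulants), and a unique infinitesimal character $\rho$ with $\Phi=\exp^*(\rho)$ (monotone cumulants), and they satisfy $$\begin{aligned} \Phi&=\exp^\prec(\kappa)=\exp^*\big(\Omega'(\kappa)\big)=\exp^\succ\big(-W(-\Omega'(\kappa))\big),\\ \Phi&=\exp^\succ(\beta)=\exp^*\big(-\Omega'(-\beta)\big)=\exp^\prec\big(W(-\Omega'(-\beta))\big),\\ \Phi&=\exp^*(\rho)=\exp^\prec\big(W(\rho)\big)=\exp^\succ\big(-W(-\rho)\big).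 \end{aligned}$$ Consequently $$\rho=\Omega'(\kappa),\quad \beta=-W(-\Omega'(\kappa));\qquad \rho=-\Omega'(-\beta),\quad \kappa=W(-\Omega'(-\beta));\qquad \kappa=W(\rho),\quad \beta=-W(-\rho).$$ -/

import Mathlib

open scoped TensorProduct DirectSum

noncomputable section

namespace CumulantShuffle

/-! ### The double tensor algebra -/

section DoubleTensor

variable (k : Type*) [Field k] (A : Type*) [Ring A] [Algebra k A]

/-- The non-unital tensor algebra `T(A) = ⨁_{n > 0} A^{⊗ n}`: the summand of index `n` is
`A^{⊗ (n+1)}`. -/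
abbrev Words : Type _ := ⨁ n : ℕ, ⨂[k]^(n + 1) A

/-- The unital tensor algebra `H` over `T(A)`; its product is the concatenation
(bar) product `w₁ | ⋯ | wₘ`. -/
abbrev DoubleTensor : Type _ := TensorAlgebra k (Words k A)

/-- The linear forms on `H`. -/
abbrev Form : Type _ := DoubleTensor k A →ₗ[k] k

variable {k A}

variable (k) in
/-- The word `a₁ ⋯ aₙ`, as an element of `H`; the empty word is the unit of `H`. -/
def word : (n : ℕ) → MultilinearMap k (fun _ : Fin n => A) (DoubleTensor k A)
  | 0 => MultilinearMap.constOfIsEmpty k _ 1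
  | n + 1 => ((TensorAlgebra.ι k).comp
      (DirectSum.lof k ℕ (fun n => ⨂[k]^(n + 1) A) n)).compMultilinearMap
        (PiTensorProduct.tprod k)

variable (k) in
/-- The subword `a_S` of `a₁ ⋯ aₙ` with letters in the positions `S`. -/
def subword {n : ℕ} (a : Fin n → A) (S : Finset (Fin n)) : DoubleTensor k A :=
  word k S.card (fun i => a (S.orderEmbOfFin rfl i))

/-- The connected component (maximal interval) of `U` whose first element is `i`. It is empty if no
connected component of `U` starts at `i`. -/
def component {n : ℕ} (U : Finset (Fin n)) (i : Fin n) : Finset (Fin n) :=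
  {j | (∀ m ∈ U, (m : ℕ) + 1 ≠ i) ∧ i ≤ j ∧ ∀ m, i ≤ m → m ≤ j → m ∈ U}

variable (k) in
/-- The bar product `a_{J₁} | ⋯ | a_{Jₗ}` over the connected components `J₁, …, Jₗ` of the
complement of `S`, in increasing order. (Positions where no component starts contribute the empty
word, that is the unit.) -/
def gaps {n : ℕ} (a : Fin n → A) (S : Finset (Fin n)) : DoubleTensor k A :=
  (List.ofFn fun i => subword k a (component Sᶜ i)).prod

theorem subword_update_of_notMem {n : ℕ} (a : Fin n → A)
    {S : Finset (Fin n)} {i : Fin n} (hi : i ∉ S) (x : A) :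
    subword k (Function.update a i x) S = subword k a S := by
  unfold subword
  congr 1
  funext j
  refine Function.update_of_ne (fun h => hi ?_) _ _
  rw [← h]
  exact S.orderEmbOfFin_mem rfl j

theorem exists_subword_update {n : ℕ} (a : Fin n → A)
    {S : Finset (Fin n)} {i : Fin n} (hi : i ∈ S) :
    ∃ f : A →ₗ[k] DoubleTensor k A, ∀ x, subword k (Function.update a i x) S = f x := by
  classical
  obtain ⟨p, hp⟩ : ∃ p, S.orderEmbOfFin rfl p = i := by
    have : i ∈ Set.range (S.orderEmbOfFin rfl) := by
      rw [Finset.range_orderEmbOfFin]; exact hi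
    exact this
  refine ⟨(word k S.card).toLinearMap (fun j => a (S.orderEmbOfFin rfl j)) p, fun x => ?_⟩
  unfold subword
  rw [MultilinearMap.toLinearMap_apply]
  congr 1
  funext j
  by_cases h : j = p
  · subst h; simp [hp]
  · rw [Function.update_of_ne h, Function.update_of_ne]
    intro h'
    exact h ((S.orderEmbOfFin rfl).injective (h'.trans hp.symm))

theorem exists_mem_component {n : ℕ} {U : Finset (Fin n)} {i : Fin n} (hi : i ∈ U) :
    ∃ j, i ∈ component U j := by
  obtain ⟨j, ⟨hji, hjU⟩, hmin⟩ := (wellFounded_lt (α := Fin n)).has_min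
    {j | j ≤ i ∧ ∀ m, j ≤ m → m ≤ i → m ∈ U}
    ⟨i, le_rfl, fun m h1 h2 => by rwa [le_antisymm h2 h1]⟩
  refine ⟨j, ?_⟩
  simp only [component, Finset.mem_filter, Finset.mem_univ, true_and]
  refine ⟨fun m hm hlt => ?_, hji, hjU⟩
  have hmj : m ≤ j := Fin.le_def.2 (by omega)
  refine hmin m ⟨hmj.trans hji, fun q h1 h2 => ?_⟩ (Fin.lt_def.2 (by omega))
  rcases eq_or_lt_of_le h1 with h | h
  · rwa [← h]
  · exact hjU q (Fin.le_def.2 (by have := Fin.lt_def.1 h; omega)) h2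

theorem component_unique {n : ℕ} {U : Finset (Fin n)} {i j j' : Fin n}
    (h : i ∈ component U j) (h' : i ∈ component U j') : j = j' := by
  have key : ∀ {j j' : Fin n}, i ∈ component U j → i ∈ component U j' → ¬ j < j' := by
    intro j j' h h' hlt
    simp only [component, Finset.mem_filter, Finset.mem_univ, true_and] at h h'
    have hlt' := Fin.lt_def.1 hlt
    have hle := Fin.le_def.1 h'.2.1
    have hm : (j' : ℕ) - 1 < n := by omega
    refine h'.1 ⟨(j' : ℕ) - 1, hm⟩ (h.2.2 _ (Fin.le_def.2 ?_) (Fin.le_def.2 ?_)) ?_ <;>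
      simp only <;> omega
  exact le_antisymm (not_lt.1 (key h' h)) (not_lt.1 (key h h'))

theorem component_subset {n : ℕ} {U : Finset (Fin n)} {i j : Fin n}
    (h : i ∈ component U j) : i ∈ U := by
  simp only [component, Finset.mem_filter, Finset.mem_univ, true_and] at h
  exact h.2.2 i h.2.1 le_rfl

theorem gaps_update_of_mem {n : ℕ} (a : Fin n → A)
    {S : Finset (Fin n)} {i : Fin n} (hi : i ∈ S) (x : A) :
    gaps k (Function.update a i x) S = gaps k a S := by
  unfold gaps
  congr 2
  funext j
  refine subword_update_of_notMem a (fun h => ?_) x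
  exact (Finset.mem_compl.1 (component_subset h)) hi

theorem exists_gaps_update {n : ℕ} (a : Fin n → A)
    {S : Finset (Fin n)} {i : Fin n} (hi : i ∉ S) :
    ∃ f : A →ₗ[k] DoubleTensor k A, ∀ x, gaps k (Function.update a i x) S = f x := by
  classical
  obtain ⟨j, hj⟩ := exists_mem_component (Finset.mem_compl.2 hi)
  obtain ⟨f, hf⟩ := exists_subword_update (k := k) a hj
  refine ⟨((MultilinearMap.mkPiAlgebraFin k n (DoubleTensor k A)).toLinearMap
    (fun l => subword k a (component Sᶜ l)) j).comp f, fun x => ?_⟩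
  rw [LinearMap.comp_apply, MultilinearMap.toLinearMap_apply,
    MultilinearMap.mkPiAlgebraFin_apply]
  unfold gaps
  congr 2
  funext l
  by_cases h : l = j
  · subst h; rw [Function.update_self]; exact hf x
  · rw [Function.update_of_ne h]
    exact subword_update_of_notMem a (fun h' => h (component_unique h' hj)) x

/-! ### The coproduct and its two halves -/

theorem exists_term_update {n : ℕ} (a : Fin n → A)
    (S : Finset (Fin n)) (i : Fin n) :
    ∃ f : A →ₗ[k] DoubleTensor k A ⊗[k] DoubleTensor k A, ∀ x,
      subword k (Function.update a i x) S ⊗ₜ[k] gaps k (Function.update a i x) S = f x := by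
  by_cases hi : i ∈ S
  · obtain ⟨f, hf⟩ := exists_subword_update (k := k) a hi
    refine ⟨((TensorProduct.mk k _ _).flip (gaps k a S)).comp f, fun x => ?_⟩
    rw [hf, gaps_update_of_mem a hi]; rfl
  · obtain ⟨f, hf⟩ := exists_gaps_update (k := k) a hi
    refine ⟨(TensorProduct.mk k _ _ (subword k a S)).comp f, fun x => ?_⟩
    rw [hf, subword_update_of_notMem a hi]; rfl

variable (k A) in
/-- The multilinear map `(a₁, …, aₙ) ↦ a_S ⊗ a_{J₁} | ⋯ | a_{Jₗ}`. -/
def coproductTerm {n : ℕ} (S : Finset (Fin n)) :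
    MultilinearMap k (fun _ : Fin n => A) (DoubleTensor k A ⊗[k] DoubleTensor k A) :=
  MultilinearMap.mk' (fun a => subword k a S ⊗ₜ[k] gaps k a S)
    (fun a i x y => by
      obtain ⟨f, hf⟩ := exists_term_update (k := k) a S i
      rw [hf, hf, hf, map_add])
    (fun a i c x => by
      obtain ⟨f, hf⟩ := exists_term_update (k := k) a S i
      rw [hf, hf, map_smul])

variable (k A) in
/-- The linear map on `T(A)` with
`a₁ ⋯ aₙ ↦ ∑_{S ∈ F} a_S ⊗ a_{J₁} | ⋯ | a_{Jₗ}`, for a family `F` of sets of positions. -/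
def wordCoproduct (F : ∀ n : ℕ, Finset (Finset (Fin (n + 1)))) :
    Words k A →ₗ[k] DoubleTensor k A ⊗[k] DoubleTensor k A :=
  DirectSum.toModule k ℕ _ fun n =>
    PiTensorProduct.lift (∑ S ∈ F n, coproductTerm k A S)

variable (k A) in
/-- The coproduct `Δ` of `H`: on words the sum over all subsets, extended multiplicatively. -/
def coproduct : DoubleTensor k A →ₐ[k] DoubleTensor k A ⊗[k] DoubleTensor k A :=
  TensorAlgebra.lift k (wordCoproduct k A fun _ => Finset.univ)

/-- The algebra morphism with `w ↦ [[0, δ(w)], [0, Δ(w)]]` for `w ∈ T(A)`. -/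
def halfMatrix (δ : Words k A →ₗ[k] DoubleTensor k A ⊗[k] DoubleTensor k A) :
    DoubleTensor k A →ₐ[k] Matrix (Fin 2) (Fin 2) (DoubleTensor k A ⊗[k] DoubleTensor k A) :=
  TensorAlgebra.lift k
    ((Matrix.singleLinearMap k (0 : Fin 2) (1 : Fin 2)).comp δ +
      (Matrix.singleLinearMap k (1 : Fin 2) (1 : Fin 2)).comp
        (wordCoproduct k A fun _ => Finset.univ))

/-- The linear map `D` on `H` that extends `δ : T(A) → H ⊗ H` by `D(𝟏) = 0` and
`D(w | b) = δ(w) · Δ(b)` for `w ∈ T(A)` and `b ∈ H` (see `halfExtend_one` and `halfExtend_mul`). -/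
def halfExtend (δ : Words k A →ₗ[k] DoubleTensor k A ⊗[k] DoubleTensor k A) :
    DoubleTensor k A →ₗ[k] DoubleTensor k A ⊗[k] DoubleTensor k A :=
  (Matrix.entryLinearMap k (DoubleTensor k A ⊗[k] DoubleTensor k A) (0 : Fin 2) (1 : Fin 2)).comp
    (halfMatrix δ).toLinearMap

theorem halfMatrix_lower (δ : Words k A →ₗ[k] DoubleTensor k A ⊗[k] DoubleTensor k A)
    (b : DoubleTensor k A) :
    halfMatrix δ b 1 0 = 0 ∧ halfMatrix δ b 1 1 = coproduct k A b := by
  induction b using TensorAlgebra.induction with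
  | algebraMap r => simp [Matrix.algebraMap_matrix_apply]
  | ι w => simp [halfMatrix, coproduct]
  | mul x y hx hy =>
    simp [Matrix.mul_apply, Fin.sum_univ_two, hx.1, hx.2, hy.1, hy.2]
  | add x y hx hy => simp [hx.1, hx.2, hy.1, hy.2]

theorem halfExtend_one (δ : Words k A →ₗ[k] DoubleTensor k A ⊗[k] DoubleTensor k A) :
    halfExtend δ 1 = 0 := by
  simp [halfExtend]

theorem halfExtend_mul (δ : Words k A →ₗ[k] DoubleTensor k A ⊗[k] DoubleTensor k A)
    (w : Words k A) (b : DoubleTensor k A) :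
    halfExtend δ (TensorAlgebra.ι k w * b) = δ w * coproduct k A b := by
  have h : halfMatrix δ (TensorAlgebra.ι k w) 0 0 = 0 ∧
      halfMatrix δ (TensorAlgebra.ι k w) 0 1 = δ w := by
    simp [halfMatrix]
  simp [halfExtend, Matrix.mul_apply, Fin.sum_univ_two, h.1, h.2, (halfMatrix_lower δ b).2]

variable (k A) in
/-- The left half-unshuffle coproduct: on words the sum over the subsets that contain the first
position. -/
def leftCoproduct : DoubleTensor k A →ₗ[k] DoubleTensor k A ⊗[k] DoubleTensor k A :=
  halfExtend (wordCoproduct k A fun _ => {S | 0 ∈ S})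

variable (k A) in
/-- The right half-unshuffle coproduct: on words the sum over the subsets that do not contain the
first position. -/
def rightCoproduct : DoubleTensor k A →ₗ[k] DoubleTensor k A ⊗[k] DoubleTensor k A :=
  halfExtend (wordCoproduct k A fun _ => {S | 0 ∉ S})

/-! ### Convolution, half-shuffle products, characters -/

/-- The convolution product `f * g = m ∘ (f ⊗ g) ∘ Δ` of linear forms. -/
def conv (f g : Form k A) : Form k A :=
  LinearMap.mul' k k ∘ₗ TensorProduct.map f g ∘ₗ (coproduct k A).toLinearMap

/-- The left half-shuffle product `f ≺ g = m ∘ (f ⊗ g) ∘ Δ_≺⁺`. Since `Δ_≺⁺(a) = Δ_≺(a) + a ⊗ 𝟏`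
for `a` in the kernel of the counit, the unit conventions `f ≺ ε = f` and `ε ≺ f = 0`, for
`f(𝟏) = 0`, are built in. -/
def prec (f g : Form k A) : Form k A :=
  LinearMap.mul' k k ∘ₗ TensorProduct.map f g ∘ₗ leftCoproduct k A

/-- The right half-shuffle product `f ≻ g = m ∘ (f ⊗ g) ∘ Δ_≻⁺`. Since
`Δ_≻⁺(a) = Δ_≻(a) + 𝟏 ⊗ a` for `a` in the kernel of the counit, the unit conventions `ε ≻ f = f`
and `f ≻ ε = 0`, for `f(𝟏) = 0`, are built in. -/
def succ (f g : Form k A) : Form k A :=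
  LinearMap.mul' k k ∘ₗ TensorProduct.map f g ∘ₗ rightCoproduct k A

/-- The left pre-Lie product `f ▷ g = f ≻ g - g ≺ f`. -/
def preLie (f g : Form k A) : Form k A := succ f g - prec g f

variable (k A) in
/-- The counit `ε` of `H`. -/
def counit : Form k A := (TensorAlgebra.algebraMapInv).toLinearMap

/-- The infinitesimal characters: linear forms that vanish on the unit and on products of two
elements of the augmentation ideal. -/
def IsInfinitesimal (f : Form k A) : Prop :=
  f 1 = 0 ∧ ∀ x y : DoubleTensor k A, counit k A x = 0 → counit k A y = 0 → f (x * y) = 0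

/-- The moment character of `φ`: the multiplicative extension to `H` of
`a₁ ⋯ aₙ ↦ φ(a₁ ·_A ⋯ ·_A aₙ)`. -/
def momentCharacter (φ : A →ₗ[k] k) : DoubleTensor k A →ₐ[k] k :=
  TensorAlgebra.lift k (DirectSum.toModule k ℕ k fun n =>
    PiTensorProduct.lift (φ.compMultilinearMap (MultilinearMap.mkPiAlgebraFin k (n + 1) A)))

/-! ### Exponentials -/

/-- `s` is the sum of the series `∑ₙ f n`, where on each element of `H` the partial sums are
eventually constant (so only finitely many terms are non-zero there). -/
def HasLocalSum (f : ℕ → Form k A) (s : Form k A) : Prop :=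
  ∀ x, ∃ N, ∀ n, N ≤ n → ∑ i ∈ Finset.range n, f i x = s x

open Classical in
/-- The sum of a series of linear forms in the sense of `HasLocalSum`, and `0` if there is none. -/
def localSum (f : ℕ → Form k A) : Form k A :=
  if h : ∃ s, HasLocalSum f s then h.choose else 0

/-- Convolution powers `f^{* n}`. -/
def convPow (f : Form k A) : ℕ → Form k A
  | 0 => counit k A
  | n + 1 => conv f (convPow f n)

/-- Left half-shuffle powers `f^{≺ (n+1)} = f ≺ f^{≺ n}`. -/
def precPow (f : Form k A) : ℕ → Form k A
  | 0 => counit k A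
  | n + 1 => prec f (precPow f n)

/-- Right half-shuffle powers `f^{≻ (n+1)} = f^{≻ n} ≻ f`. -/
def succPow (f : Form k A) : ℕ → Form k A
  | 0 => counit k A
  | n + 1 => succ (succPow f n) f

/-- The terms of `exp^*(f) = ∑ₙ f^{* n} / n!`. -/
def expConvTerm (f : Form k A) (n : ℕ) : Form k A := (n.factorial : k)⁻¹ • convPow f n

/-- The shuffle exponential `exp^*`. -/
def expConv (f : Form k A) : Form k A := localSum (expConvTerm f)

/-- The left half-shuffle exponential `exp^≺(f) = ε + ∑_{n > 0} f^{≺ n}`. -/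
def expPrec (f : Form k A) : Form k A := localSum (precPow f)

/-- The right half-shuffle exponential `exp^≻(f) = ε + ∑_{n > 0} f^{≻ n}`. -/
def expSucc (f : Form k A) : Form k A := localSum (succPow f)

/-! ### The pre-Lie Magnus expansion -/

/-- The terms of `W(f) = ∑ₙ L_{f ▷}ⁿ(f) / (n+1)!`. -/
def WTerm (f : Form k A) (n : ℕ) : Form k A :=
  ((n + 1).factorial : k)⁻¹ • (preLie f)^[n] f

/-- `W(f) = ((exp(L_{f ▷}) - 1) / L_{f ▷})(f) = f + (1/2) f ▷ f + (1/6) f ▷ (f ▷ f) + ⋯`. -/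
def W (f : Form k A) : Form k A := localSum (WTerm f)

/-- The terms of `(L_{ω ▷} / (exp(L_{ω ▷}) - 1))(f) = ∑ₘ (Bₘ / m!) L_{ω ▷}ᵐ(f)`, where `B₁ = -1/2`. -/
def magnusTerm (ω f : Form k A) (m : ℕ) : Form k A :=
  (((bernoulli m : ℚ) : k) * (m.factorial : k)⁻¹) • (preLie ω)^[m] f

/-- The fixed point equation `ω = ∑ₘ (Bₘ / m!) L_{ω ▷}ᵐ(f)` of the pre-Lie Magnus expansion, for
linear forms `ω` with `ω(𝟏) = 0`. -/
def IsMagnus (f ω : Form k A) : Prop :=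
  ω 1 = 0 ∧ HasLocalSum (magnusTerm ω f) ω

open Classical in
/-- The pre-Lie Magnus expansion `Ω'(f)`: the solution of its fixed point equation. -/
def magnus (f : Form k A) : Form k A :=
  if h : ∃ ω, IsMagnus f ω then h.choose else 0

/-! ### Cumulants -/

/-- `κ` is the infinitesimal character of free cumulants: `Φ = ε + κ ≺ Φ`. -/
def IsFreeCumulant (φ : A →ₗ[k] k) (κ : Form k A) : Prop :=
  IsInfinitesimal κ ∧
    (momentCharacter φ).toLinearMap = counit k A + prec κ (momentCharacter φ).toLinearMap

/-- `β` is the infinitesimal character of boolean cumulants: `Φ = ε + Φ ≻ β`. -/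
def IsBooleanCumulant (φ : A →ₗ[k] k) (β : Form k A) : Prop :=
  IsInfinitesimal β ∧
    (momentCharacter φ).toLinearMap = counit k A + succ (momentCharacter φ).toLinearMap β

/-- `ρ` is the infinitesimal character of monotone cumulants: `Φ = exp^*(ρ)`. -/
def IsMonotoneCumulant (φ : A →ₗ[k] k) (ρ : Form k A) : Prop :=
  IsInfinitesimal ρ ∧ (momentCharacter φ).toLinearMap = expConv ρ

end DoubleTensor

end CumulantShuffle

end

/-!
The linear forms on `H` form a complete filtered dendriform algebra, and everything follows from
computations in such algebras, together with a comparison of characters and infinitesimal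
characters.

*Coassociativity.* A set `S` of positions cuts a word into `|S| + 1` gaps, some of which may be
empty; as the empty word is the unit of `H`, the bar product of all these gaps is
`a_{J₁} | ⋯ | a_{Jₗ}`. Sums over `S` are therefore given by a recursion on letters (`cosum`), for
which coassociativity is an induction (`cosum_coassoc`). It gives the dendriform identities
`prec_prec`, `succ_prec` and `succ_succ` for all linear forms.

*Convergence.* The forms that vanish on bar words with fewer than `n` letters (`vanishing`) define a
complete separated filtration: series whose `n`-th term lies in step `n` converge
(`hasLocalSum_localSum`), and maps that raise the order of agreement of two forms have exactly one
fixed point (`exists_fixedPoint`, `eq_of_contracting`). This yields the exponentials and `Ω'`, and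
`κ ↦ exp^≺(κ)` and `β ↦ exp^≻(β)` are injective. The maps `Ω'` and `W` are mutually inverse because
the power series `∑ Bₘ tᵐ / m!` and `∑ tⁿ / (n + 1)!` are (`hasLocalSum_inverse`).

*Comparison of exponentials.* From `ρ ≻ (x ≺ y) = (ρ ▷ x) ≺ y + x ≺ (ρ * y)` and Pascal's rule one
gets `ρ^{* n} = ∑ᵢ C(n, i + 1) L_{ρ ▷}ⁱ(ρ) ≺ ρ^{* (n - 1 - i)}` (`pow_eq_sum_choose`). Division by
`n!` and summation give `exp^*(ρ) = ε + W(ρ) ≺ exp^*(ρ)`, that is `exp^*(ρ) = exp^≺(W(ρ))`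
(`expConv_eq_prec`); the mirror image is `exp^*(ρ) = exp^≻(-W(-ρ))` (`expConv_eq_succ`).

*Cumulants.* For infinitesimal `κ` and a character `Φ`, the form `κ ≺ Φ` is multiplicative on
`w | b`; hence it is enough to solve `Φ = ε + κ ≺ Φ` on words, which is a fixed point problem among
infinitesimal characters (`exists_infinitesimal`). The same holds for `Φ ≻ β`. The infinitesimal
characters are closed under `▷` (`IsInfinitesimal.preLie`), hence under `Ω'`, so that
`Ω'(κ)` is the infinitesimal character of monotone cumulants.
-/

noncomputable section

namespace CumulantShuffle

section Splittings

variable {A : Type*}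

/-! ### Splittings of words -/

/-- The sum of `G s ss u us` over all ways of distributing the letters of the bar word
`l | ws` over two bar words: the letters kept form `s | ss`, with one word for each word of
`l | ws`, and the other letters form `u | us`, which starts a new (possibly empty) word after each
kept letter and after each bar. -/
def cosum {M : Type*} [AddCommMonoid M] :
    List A → List (List A) → (List A → List (List A) → List A → List (List A) → M) → M
  | [], [], G => G [] [] [] []
  | [], w :: ws, G => cosum w ws fun s ss u us => G [] (s :: ss) [] (u :: us)
  | a :: l, ws, G => cosum l ws (fun s ss u us => G (a :: s) ss [] (u :: us)) +
      cosum l ws fun s ss u us => G s ss (a :: u) us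
termination_by l ws => (ws.length, l.length)

/-- Induction over a bar word `l | ws` that removes its first letter or its first bar. -/
theorem barWord_induction {P : List A → List (List A) → Prop} (nil : P [] [])
    (bar : ∀ w ws, P w ws → P [] (w :: ws)) (letter : ∀ a l ws, P l ws → P (a :: l) ws)
    (l : List A) (ws : List (List A)) : P l ws := by
  induction ws generalizing l with
  | nil =>
    induction l with
    | nil => exact nil
    | cons a l ih => exact letter a l _ ih
  | cons w ws ih =>
    induction l with
    | nil => exact bar w ws (ih w)
    | cons a l ih => exact letter a l _ ih

/-- Only the summands with the right total number of letters matter. -/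
theorem cosum_congr {M : Type*} [AddCommMonoid M]
    {G G' : List A → List (List A) → List A → List (List A) → M}
    (l : List A) (ws : List (List A))
    (h : ∀ s ss u us, s.length + ss.flatten.length + (u.length + us.flatten.length) =
      l.length + ws.flatten.length → G s ss u us = G' s ss u us) :
    cosum l ws G = cosum l ws G' := by
  induction l, ws using barWord_induction generalizing G G' with
  | nil => simp only [cosum]; exact h _ _ _ _ (by simp)
  | bar w ws ih =>
    simp only [cosum]
    refine ih fun s ss u us e => h _ _ _ _ ?_
    simp only [List.flatten_cons, List.length_append, List.length_nil]
    omega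
  | letter a l ws ih =>
    simp only [cosum]
    congr 1
    · refine ih fun s ss u us e => h _ _ _ _ ?_
      simp only [List.flatten_cons, List.length_append, List.length_nil, List.length_cons]
      omega
    · refine ih fun s ss u us e => h _ _ _ _ ?_
      simp only [List.length_cons]
      omega

theorem cosum_zero {M : Type*} [AddCommMonoid M] (l : List A) (ws : List (List A)) :
    cosum l ws (fun _ _ _ _ => (0 : M)) = 0 := by
  induction l, ws using barWord_induction <;> simp_all [cosum]

theorem map_cosum {M N F : Type*} [AddCommMonoid M] [AddCommMonoid N] [FunLike F M N]
    [AddMonoidHomClass F M N] (φ : F)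
    (l : List A) (ws : List (List A)) (G : List A → List (List A) → List A → List (List A) → M) :
    φ (cosum l ws G) = cosum l ws fun s ss u us => φ (G s ss u us) := by
  induction l, ws using barWord_induction generalizing G <;> simp_all [cosum]

theorem cosum_mul {R : Type*} [NonUnitalNonAssocSemiring R] (l : List A) (ws : List (List A))
    (G : List A → List (List A) → List A → List (List A) → R) (c : R) :
    cosum l ws G * c = cosum l ws fun s ss u us => G s ss u us * c :=
  map_cosum (AddMonoidHom.mulRight c) l ws G

theorem mul_cosum {R : Type*} [NonUnitalNonAssocSemiring R] (l : List A) (ws : List (List A))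
    (G : List A → List (List A) → List A → List (List A) → R) (c : R) :
    c * cosum l ws G = cosum l ws fun s ss u us => c * G s ss u us :=
  map_cosum (AddMonoidHom.mulLeft c) l ws G

theorem cosum_add {M : Type*} [AddCommMonoid M] (l : List A) (ws : List (List A))
    (G G' : List A → List (List A) → List A → List (List A) → M) :
    cosum l ws (fun s ss u us => G s ss u us + G' s ss u us) = cosum l ws G + cosum l ws G' := by
  induction l, ws using barWord_induction generalizing G G' with
  | nil => simp only [cosum]
  | bar w ws ih => simp only [cosum, ih]
  | letter a l ws ih => simp only [cosum, ih]; abel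

/-- Splitting the kept letters again, or splitting the other letters again, both enumerate the
ways of distributing the letters over three bar words. -/
theorem cosum_coassoc {M : Type*} [AddCommMonoid M] (l : List A) (ws : List (List A))
    (F : List A → List (List A) → List A → List (List A) → List A → List (List A) → M) :
    cosum l ws (fun s ss u us => cosum s ss fun t ts v vs => F t ts v vs u us) =
      cosum l ws fun t ts w wws => cosum w wws fun v vs u us => F t ts v vs u us := by
  induction l, ws using barWord_induction generalizing F with
  | nil => simp only [cosum]
  | bar w ws ih =>
    simp only [cosum]
    exact ih _
  | letter a l ws ih =>
    simp only [cosum, cosum_add]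
    rw [ih (fun t ts v vs u us => F (a :: t) ts [] (v :: vs) [] (u :: us)),
      ih (fun t ts v vs u us => F t ts (a :: v) vs [] (u :: us)), ih, add_assoc]

/-! ### Sets of positions in words -/

/-- The letters of `a` in the positions `S`, in order. -/
def letters {n : ℕ} (a : Fin n → A) (S : Finset (Fin n)) : List A :=
  ((List.finRange n).filter (· ∈ S)).map a

theorem letters_cons {n : ℕ} (x : A) (a : Fin n → A) {S : Finset (Fin (n + 1))}
    {T : Finset (Fin n)} (hT : ∀ i, i.succ ∈ S ↔ i ∈ T) :
    letters (Fin.cons x a : Fin (n + 1) → A) S = (if 0 ∈ S then [x] else []) ++ letters a T := by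
  have h : (fun i : Fin n => decide (i.succ ∈ S)) = fun i => decide (i ∈ T) := by
    funext i; simp [hT]
  simp only [letters, List.finRange_succ, List.filter_cons, List.filter_map, Function.comp_def, h]
  split_ifs <;> simp_all [Function.comp_def]

/-- The positions before the first element of `S`. -/
def openGap {n : ℕ} (S : Finset (Fin n)) : Finset (Fin n) := {j | ∀ m ≤ j, m ∉ S}

theorem letters_openGap_of_mem {n : ℕ} (a : Fin (n + 1) → A) {S : Finset (Fin (n + 1))}
    (h0 : 0 ∈ S) : letters a (openGap S) = [] := by
  have : openGap S = ∅ := by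
    ext j
    simp only [openGap, Finset.mem_filter, Finset.mem_univ, true_and, Finset.notMem_empty,
      iff_false]
    exact fun h => h 0 (Fin.zero_le _) h0
  simp [this, letters]

theorem letters_openGap_of_notMem {n : ℕ} (x : A) (a : Fin n → A) {S : Finset (Fin (n + 1))}
    {T : Finset (Fin n)} (hT : ∀ i, i.succ ∈ S ↔ i ∈ T) (h0 : 0 ∉ S) :
    letters (Fin.cons x a : Fin (n + 1) → A) (openGap S) = x :: letters a (openGap T) := by
  have h : ∀ i : Fin n, i.succ ∈ openGap S ↔ i ∈ openGap T := fun i => by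
    simp [openGap, Fin.forall_fin_succ, hT, h0]
  rw [letters_cons x a h, if_pos (by simp [openGap, h0])]
  rfl

/-- The set of positions of a word `x a` whose trace on `a` is `T` and that contains the first
position if and only if `b` holds. -/
def extendSet {n : ℕ} (b : Bool) (T : Finset (Fin n)) : Finset (Fin (n + 1)) :=
  (if b then {0} else ∅) ∪ T.map (Fin.succEmb n)

theorem succ_mem_extendSet {n : ℕ} (b : Bool) (T : Finset (Fin n)) (i : Fin n) :
    i.succ ∈ extendSet b T ↔ i ∈ T := by
  cases b <;> simp [extendSet]

theorem zero_mem_extendSet {n : ℕ} (b : Bool) (T : Finset (Fin n)) :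
    0 ∈ extendSet b T ↔ b = true := by
  cases b <;> simp [extendSet]

theorem sum_filter_extendSet {M : Type*} [AddCommMonoid M] {n : ℕ} (b : Bool)
    (p : Finset (Fin (n + 1)) → Prop) [DecidablePred p] (hp : ∀ S, p S ↔ (0 ∈ S ↔ b = true))
    (f : Finset (Fin (n + 1)) → M) :
    ∑ S with p S, f S = ∑ T, f (extendSet b T) := by
  symm
  refine Finset.sum_bij' (fun T _ => extendSet b T)
    (fun S _ => ({i | Fin.succ i ∈ S} : Finset (Fin n))) ?_ ?_ ?_ ?_ ?_
  · intro T _; simp [hp, zero_mem_extendSet]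
  · intro S _; simp
  · intro T _; ext i; simp [succ_mem_extendSet]
  · intro S hS
    have h := (hp S).1 (by simpa using hS)
    ext i
    cases i using Fin.cases with
    | zero => rw [zero_mem_extendSet, h]
    | succ i => simp [succ_mem_extendSet]
  · intro T _; rfl

end Splittings

variable {k : Type*} [Field k] {A : Type*} [Ring A] [Algebra k A]

/-! ### Bar words in the double tensor algebra -/

variable (k) in
/-- The word with the letters of a list. -/
def wd (l : List A) : DoubleTensor k A := word k l.length l.get

variable (k) in
/-- The bar product of a list of words, empty words counting as units. -/
def bar (ws : List (List A)) : DoubleTensor k A := (ws.map (wd k)).prod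

@[simp] theorem wd_nil : wd k ([] : List A) = 1 := rfl

@[simp] theorem bar_nil : bar k ([] : List (List A)) = 1 := rfl

@[simp] theorem bar_cons (w : List A) (ws : List (List A)) :
    bar k (w :: ws) = wd k w * bar k ws := by simp [bar]

theorem bar_append (ws ws' : List (List A)) : bar k (ws ++ ws') = bar k ws * bar k ws' := by
  simp [bar]

theorem word_eq_wd_ofFn {n : ℕ} (a : Fin n → A) : word k n a = wd k (List.ofFn a) := by
  have key : ∀ (m : ℕ) (b : Fin m → A) (h : m = n), (∀ i, b i = a (Fin.cast h i)) →
      word k n a = word k m b := by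
    rintro m b rfl h
    congr 1
    funext i
    exact (h i).symm
  exact key _ _ (List.length_ofFn) fun i => by simp [Fin.cast]

theorem mem_span_bar (x : DoubleTensor k A) :
    x ∈ Submodule.span k (Set.range (bar k (A := A))) := by
  induction x using TensorAlgebra.induction with
  | algebraMap r =>
    rw [Algebra.algebraMap_eq_smul_one]
    exact Submodule.smul_mem _ _ (Submodule.subset_span ⟨[], rfl⟩)
  | ι w =>
    induction w using DirectSum.induction_on with
    | zero => simp
    | of n z =>
      induction z using PiTensorProduct.induction_on with
      | smul_tprod r a =>
        have h : TensorAlgebra.ι k (DirectSum.of (fun n : ℕ => ⨂[k]^(n + 1) A) n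
            (r • PiTensorProduct.tprod k a)) = r • bar k [List.ofFn a] := by
          rw [bar_cons, bar_nil, mul_one, ← word_eq_wd_ofFn]
          change TensorAlgebra.ι k (DirectSum.lof k ℕ (fun n : ℕ => ⨂[k]^(n + 1) A) n _) = _
          rw [map_smul, map_smul]
          rfl
        rw [h]
        exact Submodule.smul_mem _ _ (Submodule.subset_span ⟨_, rfl⟩)
      | add x y hx hy => rw [map_add, map_add]; exact add_mem hx hy
    | add x y hx hy => rw [map_add]; exact add_mem hx hy
  | mul x y hx hy =>
    have h := Submodule.mul_mem_mul hx hy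
    rw [Submodule.span_mul_span] at h
    refine Submodule.span_mono ?_ h
    rintro _ ⟨_, ⟨u, rfl⟩, _, ⟨v, rfl⟩, rfl⟩
    exact ⟨u ++ v, bar_append u v⟩
  | add x y hx hy => exact add_mem hx hy

theorem bar_induction {P : DoubleTensor k A → Prop} (one : P 1)
    (cons : ∀ a l ws, P (bar k ws) → P (wd k (a :: l) * bar k ws)) (ws : List (List A)) :
    P (bar k ws) := by
  induction ws with
  | nil => exact one
  | cons w ws ih =>
    cases w with
    | nil => simpa using ih
    | cons a l => rw [bar_cons]; exact cons a l ws ih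

theorem linear_ext {M : Type*} [AddCommGroup M] [Module k M] {f g : DoubleTensor k A →ₗ[k] M}
    (h : ∀ ws, f (bar k ws) = g (bar k ws)) : f = g := by
  refine LinearMap.ext_on (Submodule.eq_top_iff'.2 mem_span_bar) ?_
  rintro _ ⟨ws, rfl⟩
  exact h ws

/-- Linear maps on `H` that agree on `𝟏` and on bar words with non-empty first word are equal. -/
theorem linear_ext_cons {M : Type*} [AddCommGroup M] [Module k M]
    {f g : DoubleTensor k A →ₗ[k] M} (one : f 1 = g 1)
    (cons : ∀ a l ws, f (wd k (a :: l) * bar k ws) = g (wd k (a :: l) * bar k ws)) : f = g :=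
  linear_ext (bar_induction (P := fun x => f x = g x) one fun a l ws _ => cons a l ws)

/-! ### The coproduct of a word as a sum over splittings -/

theorem subword_eq_wd {n : ℕ} (a : Fin n → A) (S : Finset (Fin n)) :
    subword k a S = wd k (letters a S) := by
  have hs : (List.finRange n).filter (· ∈ S) = S.sort := by
    refine List.Pairwise.eq_of_mem_iff (r := (· < ·)) ((List.pairwise_lt_finRange n).filter _)
      (Finset.sortedLT_sort S).pairwise fun i => by simp
  rw [subword, word_eq_wd_ofFn, letters, hs]
  congr 1
  refine List.ext_getElem (by simp) fun i h1 h2 => ?_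
  simp [Finset.orderEmbOfFin_apply]

variable (k) in
/-- The bar product over the connected components of the complement of `S` that do not start at
the first position. -/
def closedGaps {n : ℕ} (a : Fin n → A) (S : Finset (Fin n)) : DoubleTensor k A :=
  (List.ofFn fun i : Fin n => if (i : ℕ) = 0 then 1 else subword k a (component Sᶜ i)).prod

theorem gaps_eq_mul {n : ℕ} (a : Fin n → A) (S : Finset (Fin n)) :
    gaps k a S = wd k (letters a (openGap S)) * closedGaps k a S := by
  cases n with
  | zero => simp [gaps, closedGaps, letters]
  | succ n =>
    have h : component Sᶜ 0 = openGap S := by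
      ext j
      simp [component, openGap]
    simp [gaps, closedGaps, List.ofFn_succ, h, subword_eq_wd]

theorem mem_component {n : ℕ} {U : Finset (Fin n)} {i j : Fin n} :
    j ∈ component U i ↔ (∀ m ∈ U, (m : ℕ) + 1 ≠ i) ∧ i ≤ j ∧ ∀ m, i ≤ m → m ≤ j → m ∈ U := by
  simp [component]

theorem component_succ {n : ℕ} {S : Finset (Fin (n + 1))} {T : Finset (Fin n)}
    (hT : ∀ i, i.succ ∈ S ↔ i ∈ T) {i : Fin n} (hi : 0 ∈ S ∨ (i : ℕ) ≠ 0) (j : Fin n) :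
    j.succ ∈ component Sᶜ i.succ ↔ j ∈ component Tᶜ i := by
  simp only [mem_component, Fin.forall_fin_succ, Finset.mem_compl, hT, Fin.val_succ,
    Fin.succ_le_succ_iff, Fin.val_zero, Fin.succ_ne_zero, Fin.le_zero_iff, false_imp_iff, true_and]
  constructor
  · rintro ⟨⟨-, h⟩, h1, h2⟩
    exact ⟨fun m hm e => h m hm (by omega), h1, h2⟩
  · rintro ⟨h, h1, h2⟩
    refine ⟨⟨fun h0 e => ?_, fun m hm e => h m hm (by omega)⟩, h1, h2⟩
    rcases hi with hi | hi
    · exact h0 hi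
    · omega

theorem zero_notMem_component_succ {n : ℕ} (U : Finset (Fin (n + 1))) (i : Fin n) :
    0 ∉ component U i.succ := by
  simp [mem_component]

theorem subword_component_succ {n : ℕ} (x : A) (a : Fin n → A) {S : Finset (Fin (n + 1))}
    {T : Finset (Fin n)} (hT : ∀ i, i.succ ∈ S ↔ i ∈ T) {i : Fin n}
    (hi : 0 ∈ S ∨ (i : ℕ) ≠ 0) :
    subword k (Fin.cons x a : Fin (n + 1) → A) (component Sᶜ i.succ) =
      subword k a (component Tᶜ i) := by
  rw [subword_eq_wd, subword_eq_wd, letters_cons x a (component_succ hT hi),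
    if_neg (zero_notMem_component_succ _ _), List.nil_append]

theorem closedGaps_cons_of_mem {n : ℕ} (x : A) (a : Fin n → A) {S : Finset (Fin (n + 1))}
    {T : Finset (Fin n)} (hT : ∀ i, i.succ ∈ S ↔ i ∈ T) (h0 : 0 ∈ S) :
    closedGaps k (Fin.cons x a : Fin (n + 1) → A) S = gaps k a T := by
  simp [closedGaps, gaps, List.ofFn_succ, subword_component_succ x a hT (Or.inl h0)]

theorem closedGaps_cons_of_notMem {n : ℕ} (x : A) (a : Fin n → A) {S : Finset (Fin (n + 1))}
    {T : Finset (Fin n)} (hT : ∀ i, i.succ ∈ S ↔ i ∈ T) (h0 : 0 ∉ S) :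
    closedGaps k (Fin.cons x a : Fin (n + 1) → A) S = closedGaps k a T := by
  simp only [closedGaps, List.ofFn_succ, Fin.val_zero, if_true, List.prod_cons, one_mul,
    Fin.val_succ, Nat.add_eq_zero_iff, one_ne_zero, and_false, if_false]
  congr 2
  funext i
  split_ifs with hi
  · -- the complement of `S` contains `0`, so that no component starts at `1`
    have : component Sᶜ i.succ = ∅ := by
      ext j
      simp only [mem_component, Finset.notMem_empty, iff_false]
      rintro ⟨h, -⟩
      exact h 0 (Finset.mem_compl.2 h0) (by simp [hi])
    rw [this, subword_eq_wd]
    simp [letters]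
  · exact subword_component_succ x a hT (Or.inr hi)

/-- The sum over all sets of positions, described by the subword, the first gap and the other gaps,
is the recursively defined sum over splittings. -/
theorem sum_splittings {M : Type*} [AddCommMonoid M] {n : ℕ} (a : Fin n → A)
    (G : List A → List A → DoubleTensor k A → M) :
    ∑ S, G (letters a S) (letters a (openGap S)) (closedGaps k a S) =
      cosum (List.ofFn a) [] fun s _ u us => G s u (bar k us) := by
  induction n generalizing G with
  | zero => simp [cosum, letters, closedGaps]
  | succ n ih =>
    obtain ⟨x, a, rfl⟩ : ∃ x b, a = Fin.cons x b := ⟨a 0, Fin.tail a, (Fin.cons_self_tail a).symm⟩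
    rw [← Finset.sum_filter_add_sum_filter_not _ (fun S => 0 ∈ S),
      sum_filter_extendSet true _ (by simp), sum_filter_extendSet false _ (by simp),
      List.ofFn_succ, cosum]
    simp only [Fin.cons_zero, Fin.cons_succ]
    congr 1
    · have e := ih a fun s u h => G (x :: s) [] (wd k u * h)
      simp only [← bar_cons] at e
      rw [← e]
      refine Finset.sum_congr rfl fun T _ => ?_
      have h0 : 0 ∈ extendSet true T := by simp [zero_mem_extendSet]
      rw [letters_cons x a (succ_mem_extendSet true T), if_pos h0, letters_openGap_of_mem _ h0,
        closedGaps_cons_of_mem x a (succ_mem_extendSet true T) h0, gaps_eq_mul]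
      rfl
    · rw [← ih a fun s u h => G s (x :: u) h]
      refine Finset.sum_congr rfl fun T _ => ?_
      have h0 : 0 ∉ extendSet false T := by simp [zero_mem_extendSet]
      rw [letters_cons x a (succ_mem_extendSet false T), if_neg h0,
        letters_openGap_of_notMem x a (succ_mem_extendSet false T) h0,
        closedGaps_cons_of_notMem x a (succ_mem_extendSet false T) h0]
      rfl

/-! ### The coproducts of bar words as sums over splittings -/

variable (k) in
/-- The word with first letter `a` and further letters `l`, as an element of `T(A)`. -/
def wordElement (a : A) (l : List A) : Words k A :=
  DirectSum.lof k ℕ (fun n => ⨂[k]^(n + 1) A) l.length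
    (PiTensorProduct.tprod k (Fin.cons a l.get : Fin (l.length + 1) → A))

theorem wd_cons (a : A) (l : List A) : wd k (a :: l) = TensorAlgebra.ι k (wordElement k a l) := by
  have h : (a :: l) = List.ofFn (Fin.cons a l.get : Fin (l.length + 1) → A) := by
    simp [List.ofFn_succ]
  rw [h, ← word_eq_wd_ofFn]
  rfl

theorem wordCoproduct_wordElement (F : ∀ n : ℕ, Finset (Finset (Fin (n + 1)))) (a : A)
    (l : List A) : wordCoproduct k A F (wordElement k a l) =
      ∑ S ∈ F l.length, wd k (letters (Fin.cons a l.get : Fin (l.length + 1) → A) S) ⊗ₜ[k]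
        gaps k (Fin.cons a l.get : Fin (l.length + 1) → A) S := by
  rw [wordCoproduct, wordElement, DirectSum.toModule_lof, PiTensorProduct.lift.tprod,
    sum_apply]
  exact Finset.sum_congr rfl fun S _ => by rw [← subword_eq_wd]; rfl

theorem leftCoproduct_word (a : A) (l : List A) :
    wordCoproduct k A (fun _ => {S | 0 ∈ S}) (wordElement k a l) =
      cosum l [] fun s _ u us => wd k (a :: s) ⊗ₜ[k] (wd k u * bar k us) := by
  rw [wordCoproduct_wordElement, sum_filter_extendSet true _ (by simp)]
  have e := sum_splittings l.get fun s u h => wd k (a :: s) ⊗ₜ[k] (wd k u * h)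
  rw [List.ofFn_get] at e
  rw [← e]
  refine Finset.sum_congr rfl fun T _ => ?_
  have h0 : 0 ∈ extendSet true T := by simp [zero_mem_extendSet]
  rw [letters_cons a _ (succ_mem_extendSet true T), if_pos h0, gaps_eq_mul,
    letters_openGap_of_mem _ h0, closedGaps_cons_of_mem a _ (succ_mem_extendSet true T) h0,
    gaps_eq_mul, wd_nil, one_mul]
  rfl

theorem rightCoproduct_word (a : A) (l : List A) :
    wordCoproduct k A (fun _ => {S | 0 ∉ S}) (wordElement k a l) =
      cosum l [] fun s _ u us => wd k s ⊗ₜ[k] (wd k (a :: u) * bar k us) := by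
  rw [wordCoproduct_wordElement, sum_filter_extendSet false _ (by simp)]
  have e := sum_splittings l.get fun s u h => wd k s ⊗ₜ[k] (wd k (a :: u) * h)
  rw [List.ofFn_get] at e
  rw [← e]
  refine Finset.sum_congr rfl fun T _ => ?_
  have h0 : 0 ∉ extendSet false T := by simp [zero_mem_extendSet]
  rw [letters_cons a _ (succ_mem_extendSet false T), if_neg h0, gaps_eq_mul,
    letters_openGap_of_notMem a _ (succ_mem_extendSet false T) h0,
    closedGaps_cons_of_notMem a _ (succ_mem_extendSet false T) h0]
  rfl

theorem coproduct_wd (l : List A) :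
    coproduct k A (wd k l) = cosum l [] fun s _ u us => wd k s ⊗ₜ[k] (wd k u * bar k us) := by
  cases l with
  | nil => simp [cosum, Algebra.TensorProduct.one_def]
  | cons a l =>
    rw [wd_cons, coproduct, TensorAlgebra.lift_ι_apply, cosum]
    simp only [wd_nil, one_mul, bar_cons]
    rw [← leftCoproduct_word, ← rightCoproduct_word]
    simp only [wordCoproduct_wordElement]
    rw [Finset.sum_filter_add_sum_filter_not]

/-- Multiplying by a coproduct from the right extends a sum over the splittings of a word to a sum
over the splittings of a bar word. -/
theorem cosum_mul_coproduct (l : List A) (ws : List (List A)) (X Y : List A → DoubleTensor k A) :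
    (cosum l [] fun s _ u us => X s ⊗ₜ[k] (Y u * bar k us)) * coproduct k A (bar k ws) =
      cosum l ws fun s ss u us => (X s * bar k ss) ⊗ₜ[k] (Y u * bar k us) := by
  induction l, ws using barWord_induction generalizing X Y with
  | nil => simp [cosum, -Algebra.TensorProduct.tmul_mul_tmul]
  | bar w ws ih =>
    rw [bar_cons, map_mul, coproduct_wd, ih]
    simp only [cosum, mul_cosum, Algebra.TensorProduct.tmul_mul_tmul, bar_nil, mul_one, bar_cons]
  | letter a l ws ih =>
    simp only [cosum, add_mul, bar_cons, ← mul_assoc]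
    rw [ih (fun s => X (a :: s)) fun u => Y [] * wd k u, ih X fun u => Y (a :: u)]

theorem coproduct_bar (l : List A) (ws : List (List A)) :
    coproduct k A (wd k l * bar k ws) =
      cosum l ws fun s ss u us => bar k (s :: ss) ⊗ₜ[k] bar k (u :: us) := by
  rw [map_mul, coproduct_wd, cosum_mul_coproduct]
  simp only [bar_cons]

theorem leftCoproduct_wd_mul (a : A) (l : List A) (x : DoubleTensor k A) :
    leftCoproduct k A (wd k (a :: l) * x) =
      (cosum l [] fun s _ u us => wd k (a :: s) ⊗ₜ[k] (wd k u * bar k us)) * coproduct k A x := by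
  rw [wd_cons, leftCoproduct, halfExtend_mul, leftCoproduct_word]

theorem rightCoproduct_wd_mul (a : A) (l : List A) (x : DoubleTensor k A) :
    rightCoproduct k A (wd k (a :: l) * x) =
      (cosum l [] fun s _ u us => wd k s ⊗ₜ[k] (wd k (a :: u) * bar k us)) * coproduct k A x := by
  rw [wd_cons, rightCoproduct, halfExtend_mul, rightCoproduct_word]

/-! ### The products of linear forms -/

theorem conv_bar (f g : Form k A) (l : List A) (ws : List (List A)) :
    conv f g (wd k l * bar k ws) = cosum l ws fun s ss u us =>
      f (bar k (s :: ss)) * g (bar k (u :: us)) := by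
  simp only [conv, LinearMap.comp_apply, AlgHom.toLinearMap_apply, coproduct_bar, map_cosum,
    TensorProduct.map_tmul, LinearMap.mul'_apply]

theorem prec_bar (f g : Form k A) (a : A) (l : List A) (ws : List (List A)) :
    prec f g (wd k (a :: l) * bar k ws) = cosum l ws fun s ss u us =>
      f (wd k (a :: s) * bar k ss) * g (wd k u * bar k us) := by
  simp only [prec, LinearMap.comp_apply, leftCoproduct_wd_mul]
  rw [cosum_mul_coproduct l ws (fun s => wd k (a :: s)) (wd k)]
  simp only [map_cosum, TensorProduct.map_tmul, LinearMap.mul'_apply]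

theorem succ_bar (f g : Form k A) (a : A) (l : List A) (ws : List (List A)) :
    succ f g (wd k (a :: l) * bar k ws) = cosum l ws fun s ss u us =>
      f (wd k s * bar k ss) * g (wd k (a :: u) * bar k us) := by
  simp only [succ, LinearMap.comp_apply, rightCoproduct_wd_mul]
  rw [cosum_mul_coproduct l ws (wd k) (fun u => wd k (a :: u))]
  simp only [map_cosum, TensorProduct.map_tmul, LinearMap.mul'_apply]

theorem conv_one (f g : Form k A) : conv f g 1 = f 1 * g 1 := by
  simp [conv, Algebra.TensorProduct.one_def]

@[simp] theorem prec_one (f g : Form k A) : prec f g 1 = 0 := by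
  simp [prec, leftCoproduct, halfExtend_one]

@[simp] theorem succ_one (f g : Form k A) : succ f g 1 = 0 := by
  simp [succ, rightCoproduct, halfExtend_one]

theorem conv_eq_prec_add_succ {f g : Form k A} (h : f 1 * g 1 = 0) :
    conv f g = prec f g + succ f g := by
  refine linear_ext_cons (by simp [conv_one, h]) fun a l ws => ?_
  rw [LinearMap.add_apply, conv_bar, prec_bar, succ_bar, cosum]
  simp only [bar_cons, wd_nil, one_mul]

/-- The first dendriform identity: in both sides the first letter goes to `f`. -/
theorem prec_prec (f g h : Form k A) : prec (prec f g) h = prec f (conv g h) := by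
  refine linear_ext_cons (by simp) fun a l ws => ?_
  simp only [prec_bar, conv_bar, cosum_mul, mul_cosum, ← mul_assoc, bar_cons]
  exact cosum_coassoc l ws fun t ts v vs u us => f (wd k (a :: t) * bar k ts) *
    g (wd k v * bar k vs) * h (wd k u * bar k us)

/-- The second dendriform identity: in both sides the first letter goes to `g`. -/
theorem succ_prec (f g h : Form k A) : prec (succ f g) h = succ f (prec g h) := by
  refine linear_ext_cons (by simp) fun a l ws => ?_
  simp only [prec_bar, succ_bar, cosum_mul, mul_cosum, ← mul_assoc]
  exact cosum_coassoc l ws fun t ts v vs u us => f (wd k t * bar k ts) *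
    g (wd k (a :: v) * bar k vs) * h (wd k u * bar k us)

/-- The third dendriform identity: in both sides the first letter goes to `h`. -/
theorem succ_succ (f g h : Form k A) : succ (conv f g) h = succ f (succ g h) := by
  refine linear_ext_cons (by simp) fun a l ws => ?_
  simp only [conv_bar, succ_bar, cosum_mul, mul_cosum, ← mul_assoc, bar_cons]
  exact cosum_coassoc l ws fun t ts v vs u us => f (wd k t * bar k ts) *
    g (wd k v * bar k vs) * h (wd k (a :: u) * bar k us)

theorem conv_assoc (f g h : Form k A) : conv (conv f g) h = conv f (conv g h) := by
  refine linear_ext_cons (by simp [conv_one, mul_assoc]) fun a l ws => ?_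
  simp only [conv_bar, bar_cons, cosum_mul, mul_cosum, ← mul_assoc]
  exact cosum_coassoc (a :: l) ws fun t ts v vs u us => f (wd k t * bar k ts) *
    g (wd k v * bar k vs) * h (wd k u * bar k us)

/-! ### The counit -/

@[simp] theorem counit_one : counit k A 1 = 1 := by simp [counit]

@[simp] theorem counit_mul (x y : DoubleTensor k A) :
    counit k A (x * y) = counit k A x * counit k A y := by simp [counit]

@[simp] theorem counit_wd_cons (a : A) (l : List A) : counit k A (wd k (a :: l)) = 0 := by
  simp [counit, wd_cons, TensorAlgebra.algebraMapInv]

theorem bar_eq_one {ws : List (List A)} (h : ws.flatten = []) : bar k ws = 1 := by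
  induction ws with
  | nil => rfl
  | cons w ws ih =>
    obtain ⟨rfl, h⟩ : w = [] ∧ ws.flatten = [] := by simpa using h
    simp [ih h]

/-- A splitting sum whose terms are weighted by the counit of the kept part reduces to the
splitting that keeps no letter. -/
theorem cosum_counit_left (f : Form k A) (Y : List A → DoubleTensor k A) (l : List A)
    (ws : List (List A)) : (cosum l ws fun s ss u us =>
      counit k A (wd k s * bar k ss) * f (Y u * bar k us)) = f (Y l * bar k ws) := by
  induction l, ws using barWord_induction generalizing f Y with
  | nil => simp [cosum]
  | bar w ws ih =>
    simp only [cosum, wd_nil, bar_cons, one_mul, ← mul_assoc]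
    rw [ih f fun u => Y [] * wd k u]
  | letter a l ws ih =>
    simp only [cosum, counit_mul, counit_wd_cons, zero_mul, cosum_zero, zero_add]
    simpa using ih f fun u => Y (a :: u)

/-- A splitting sum whose terms are weighted by the counit of the removed part reduces to the
splitting that keeps all letters. -/
theorem cosum_counit_right (f : Form k A) (X : List A → DoubleTensor k A) (l : List A)
    (ws : List (List A)) : (cosum l ws fun s ss u us =>
      f (X s * bar k ss) * counit k A (wd k u * bar k us)) = f (X l * bar k ws) := by
  induction l, ws using barWord_induction generalizing f X with
  | nil => simp [cosum]
  | bar w ws ih =>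
    simp only [cosum, wd_nil, bar_cons, one_mul, ← mul_assoc]
    rw [ih f fun u => X [] * wd k u]
  | letter a l ws ih =>
    simp only [cosum, counit_mul, counit_wd_cons, zero_mul, mul_zero, cosum_zero, add_zero,
      bar_cons, wd_nil]
    simpa using ih f fun u => X (a :: u)

theorem conv_counit (f : Form k A) : conv f (counit k A) = f := by
  refine linear_ext_cons (by simp [conv_one]) fun a l ws => ?_
  simp only [conv_bar, bar_cons]
  exact cosum_counit_right f (wd k) _ ws

theorem counit_conv (f : Form k A) : conv (counit k A) f = f := by
  refine linear_ext_cons (by simp [conv_one]) fun a l ws => ?_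
  simp only [conv_bar, bar_cons]
  exact cosum_counit_left f (wd k) _ ws

theorem prec_counit {f : Form k A} (h : f 1 = 0) : prec f (counit k A) = f := by
  refine linear_ext_cons (by simp [h]) fun a l ws => ?_
  rw [prec_bar]
  exact cosum_counit_right f (fun s => wd k (a :: s)) l ws

theorem counit_succ {f : Form k A} (h : f 1 = 0) : succ (counit k A) f = f := by
  refine linear_ext_cons (by simp [h]) fun a l ws => ?_
  rw [succ_bar]
  exact cosum_counit_left f (fun u => wd k (a :: u)) l ws

theorem counit_prec (f : Form k A) : prec (counit k A) f = 0 := by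
  refine linear_ext_cons (by simp) fun a l ws => ?_
  simp [prec_bar, cosum_zero]

theorem succ_counit (f : Form k A) : succ f (counit k A) = 0 := by
  refine linear_ext_cons (by simp) fun a l ws => ?_
  simp [succ_bar, cosum_zero]

/-! ### Bilinearity -/

variable (k A) in
/-- The left half-shuffle product as a bilinear map. -/
def precBilin : Form k A →ₗ[k] Form k A →ₗ[k] Form k A :=
  LinearMap.mk₂ k prec
    (fun f f' g => by simp [prec, TensorProduct.map_add_left, LinearMap.add_comp,
      LinearMap.comp_add])
    (fun c f g => by simp [prec, TensorProduct.map_smul_left, LinearMap.smul_comp,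
      LinearMap.comp_smul])
    (fun f g g' => by simp [prec, TensorProduct.map_add_right, LinearMap.add_comp,
      LinearMap.comp_add])
    (fun c f g => by simp [prec, TensorProduct.map_smul_right, LinearMap.smul_comp,
      LinearMap.comp_smul])

variable (k A) in
/-- The right half-shuffle product as a bilinear map. -/
def succBilin : Form k A →ₗ[k] Form k A →ₗ[k] Form k A :=
  LinearMap.mk₂ k succ
    (fun f f' g => by simp [succ, TensorProduct.map_add_left, LinearMap.add_comp,
      LinearMap.comp_add])
    (fun c f g => by simp [succ, TensorProduct.map_smul_left, LinearMap.smul_comp,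
      LinearMap.comp_smul])
    (fun f g g' => by simp [succ, TensorProduct.map_add_right, LinearMap.add_comp,
      LinearMap.comp_add])
    (fun c f g => by simp [succ, TensorProduct.map_smul_right, LinearMap.smul_comp,
      LinearMap.comp_smul])

variable (k A) in
/-- The convolution product as a bilinear map. -/
def convBilin : Form k A →ₗ[k] Form k A →ₗ[k] Form k A :=
  LinearMap.mk₂ k conv
    (fun f f' g => by simp [conv, TensorProduct.map_add_left, LinearMap.add_comp,
      LinearMap.comp_add])
    (fun c f g => by simp [conv, TensorProduct.map_smul_left, LinearMap.smul_comp,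
      LinearMap.comp_smul])
    (fun f g g' => by simp [conv, TensorProduct.map_add_right, LinearMap.add_comp,
      LinearMap.comp_add])
    (fun c f g => by simp [conv, TensorProduct.map_smul_right, LinearMap.smul_comp,
      LinearMap.comp_smul])

theorem precBilin_apply (f g : Form k A) : precBilin k A f g = prec f g := rfl

theorem succBilin_apply (f g : Form k A) : succBilin k A f g = succ f g := rfl

variable (k A) in
/-- The pre-Lie product as a bilinear map. -/
def preLieBilin : Form k A →ₗ[k] Form k A →ₗ[k] Form k A :=
  LinearMap.mk₂ k preLie
    (fun f f' g => by simp only [preLie, ← precBilin_apply, ← succBilin_apply, map_add,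
      LinearMap.add_apply]; abel)
    (fun c f g => by simp only [preLie, ← precBilin_apply, ← succBilin_apply, map_smul,
      LinearMap.smul_apply, smul_sub])
    (fun f g g' => by simp only [preLie, ← precBilin_apply, ← succBilin_apply, map_add,
      LinearMap.add_apply]; abel)
    (fun c f g => by simp only [preLie, ← precBilin_apply, ← succBilin_apply, map_smul,
      LinearMap.smul_apply, smul_sub])

theorem preLieBilin_apply (f g : Form k A) : preLieBilin k A f g = preLie f g := rfl

theorem coe_preLieBilin (f : Form k A) : ⇑(preLieBilin k A f) = preLie f := rfl

/-! ### The filtration by degree -/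

variable (k A) in
/-- The linear forms that vanish on all bar words with fewer than `n` letters. -/
def vanishing (n : ℕ) : Submodule k (Form k A) where
  carrier := {f | ∀ ws : List (List A), ws.flatten.length < n → f (bar k ws) = 0}
  add_mem' hf hg ws h := by simp [hf ws h, hg ws h]
  zero_mem' _ _ := rfl
  smul_mem' c f hf ws h := by simp [hf ws h]

theorem vanishing_anti : Antitone (vanishing k A) :=
  fun _ _ h _ hf ws hws => hf ws (hws.trans_le h)

theorem mem_vanishing_zero (f : Form k A) : f ∈ vanishing k A 0 := fun _ h => by simp at h

theorem mem_vanishing_one {f : Form k A} : f ∈ vanishing k A 1 ↔ f 1 = 0 := by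
  refine ⟨fun h => h [] (by simp), fun h ws hws => ?_⟩
  rwa [bar_eq_one (List.length_eq_zero_iff.1 (by omega))]

theorem mem_vanishing_of_cons {n : ℕ} {f : Form k A} (one : 0 < n → f 1 = 0)
    (cons : ∀ a l ws, l.length + 1 + ws.flatten.length < n → f (wd k (a :: l) * bar k ws) = 0) :
    f ∈ vanishing k A n := by
  intro ws
  induction ws with
  | nil => exact fun h => one (by simpa using h)
  | cons w ws ih =>
    cases w with
    | nil => simpa using ih
    | cons a l =>
      intro h
      rw [bar_cons]
      refine cons a l ws ?_
      simp only [List.flatten_cons, List.length_append, List.length_cons] at h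
      omega

theorem eq_zero_of_forall_mem_vanishing {f : Form k A} (h : ∀ n, f ∈ vanishing k A n) : f = 0 :=
  linear_ext fun ws => h _ ws (Nat.lt_succ_self _)

/-- Every element of `H` has bounded degree. -/
theorem exists_degree_bound (x : DoubleTensor k A) :
    ∃ d, ∀ f ∈ vanishing k A d, f x = 0 := by
  induction mem_span_bar x using Submodule.span_induction with
  | mem x h => obtain ⟨ws, rfl⟩ := h; exact ⟨_, fun f hf => hf ws (Nat.lt_succ_self _)⟩
  | zero => exact ⟨0, fun f _ => map_zero f⟩
  | add x y _ _ hx hy =>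
    obtain ⟨d, hd⟩ := hx
    obtain ⟨e, he⟩ := hy
    refine ⟨max d e, fun f hf => ?_⟩
    rw [map_add, hd f (vanishing_anti (le_max_left _ _) hf),
      he f (vanishing_anti (le_max_right _ _) hf), add_zero]
  | smul c x _ hx =>
    obtain ⟨d, hd⟩ := hx
    exact ⟨d, fun f hf => by rw [map_smul, hd f hf, smul_zero]⟩

theorem mul_eq_zero_of_vanishing {f g : Form k A} {m n : ℕ} (hf : f ∈ vanishing k A m)
    (hg : g ∈ vanishing k A n) {ws us : List (List A)}
    (h : ws.flatten.length + us.flatten.length < m + n) : f (bar k ws) * g (bar k us) = 0 := by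
  rcases lt_or_ge ws.flatten.length m with h' | h'
  · rw [hf ws h', zero_mul]
  · rw [hg us (by omega), mul_zero]

theorem prec_mem {f g : Form k A} {m n : ℕ} (hf : f ∈ vanishing k A m)
    (hg : g ∈ vanishing k A n) : prec f g ∈ vanishing k A (m + n) := by
  refine mem_vanishing_of_cons (fun _ => prec_one f g) fun a l ws h => ?_
  rw [prec_bar, ← cosum_zero l ws]
  refine cosum_congr l ws fun s ss u us e => ?_
  have := mul_eq_zero_of_vanishing hf hg (ws := (a :: s) :: ss) (us := u :: us)
    (by simp only [List.flatten_cons, List.length_append, List.length_cons]; omega)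
  simpa using this

theorem succ_mem {f g : Form k A} {m n : ℕ} (hf : f ∈ vanishing k A m)
    (hg : g ∈ vanishing k A n) : succ f g ∈ vanishing k A (m + n) := by
  refine mem_vanishing_of_cons (fun _ => succ_one f g) fun a l ws h => ?_
  rw [succ_bar, ← cosum_zero l ws]
  refine cosum_congr l ws fun s ss u us e => ?_
  have := mul_eq_zero_of_vanishing hf hg (ws := s :: ss) (us := (a :: u) :: us)
    (by simp only [List.flatten_cons, List.length_append, List.length_cons]; omega)
  simpa using this

theorem conv_mem {f g : Form k A} {m n : ℕ} (hf : f ∈ vanishing k A m)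
    (hg : g ∈ vanishing k A n) : conv f g ∈ vanishing k A (m + n) := by
  refine mem_vanishing_of_cons (fun h => ?_) fun a l ws h => ?_
  · rw [conv_one]
    exact mul_eq_zero_of_vanishing hf hg (ws := []) (us := []) (by simpa using h)
  · rw [conv_bar, ← cosum_zero (a :: l) ws]
    refine cosum_congr (a :: l) ws fun s ss u us e => ?_
    exact mul_eq_zero_of_vanishing hf hg (ws := s :: ss) (us := u :: us)
      (by simp only [List.flatten_cons, List.length_append, List.length_cons] at *; omega)

theorem preLie_mem {f g : Form k A} {m n : ℕ} (hf : f ∈ vanishing k A m)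
    (hg : g ∈ vanishing k A n) : preLie f g ∈ vanishing k A (m + n) :=
  sub_mem (succ_mem hf hg) (add_comm n m ▸ prec_mem hg hf)

/-! ### Series and fixed points -/

theorem HasLocalSum.unique {f : ℕ → Form k A} {s t : Form k A} (hs : HasLocalSum f s)
    (ht : HasLocalSum f t) : s = t := by
  ext x : 1
  obtain ⟨N, hN⟩ := hs x
  obtain ⟨M, hM⟩ := ht x
  rw [← hN _ (le_max_left N M), hM _ (le_max_right N M)]

theorem HasLocalSum.localSum_eq {f : ℕ → Form k A} {s : Form k A} (hs : HasLocalSum f s) :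
    localSum f = s := by
  have h : ∃ s, HasLocalSum f s := ⟨s, hs⟩
  rw [localSum, dif_pos h]
  exact h.choose_spec.unique hs

theorem hasLocalSum_localSum {f : ℕ → Form k A} (hf : ∀ n, f n ∈ vanishing k A n) :
    HasLocalSum f (localSum f) := by
  -- `d x` bounds the degree of `x`, so that only the terms of index below `d x` matter on `x`
  choose d hd using exists_degree_bound (k := k) (A := A)
  have key : ∀ x N, d x ≤ N →
      ∑ i ∈ Finset.range N, f i x = ∑ i ∈ Finset.range (d x), f i x := fun x N h => by
    refine (Finset.sum_subset (Finset.range_mono h) fun i _ hi => hd x _ ?_).symm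
    exact vanishing_anti (by simpa using hi) (hf i)
  let s : Form k A :=
    { toFun := fun x => ∑ i ∈ Finset.range (d x), f i x
      map_add' := fun x y => by
        have h := le_max_left (max (d x) (d y)) (d (x + y))
        rw [← key _ _ ((le_max_left _ _).trans h), ← key _ _ ((le_max_right _ _).trans h),
          ← key (x + y) _ (le_max_right (max (d x) (d y)) _), ← Finset.sum_add_distrib]
        simp
      map_smul' := fun c x => by
        rw [← key _ _ (le_max_left (d x) (d (c • x))), ← key _ _ (le_max_right (d x) (d (c • x)))]
        simp [Finset.mul_sum] }
  have hs : HasLocalSum f s := fun x => ⟨d x, key x⟩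
  rwa [hs.localSum_eq]

theorem hasLocalSum_iff {f : ℕ → Form k A} (hf : ∀ n, f n ∈ vanishing k A n) {s : Form k A} :
    HasLocalSum f s ↔ ∀ N, s - ∑ i ∈ Finset.range N, f i ∈ vanishing k A N := by
  refine ⟨fun hs N ws hws => ?_, fun hs x => ?_⟩
  · obtain ⟨M, hM⟩ := hs (bar k ws)
    rw [LinearMap.sub_apply, ← hM _ (le_max_left M N), LinearMap.sum_apply, sub_eq_zero]
    refine (Finset.sum_subset (Finset.range_mono (le_max_right M N)) fun i _ hi => hf i ws ?_).symm
    exact hws.trans_le (by simpa using hi)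
  · obtain ⟨d, hd⟩ := exists_degree_bound x
    refine ⟨d, fun n hn => ?_⟩
    have := hd _ (vanishing_anti hn (hs n))
    rw [LinearMap.sub_apply, LinearMap.sum_apply, sub_eq_zero] at this
    exact this.symm

theorem localSum_sub_mem {f : ℕ → Form k A} (hf : ∀ n, f n ∈ vanishing k A n) (N : ℕ) :
    localSum f - ∑ i ∈ Finset.range N, f i ∈ vanishing k A N :=
  (hasLocalSum_iff hf).1 (hasLocalSum_localSum hf) N

theorem localSum_mem_one {f : ℕ → Form k A} (hf : ∀ n, f n ∈ vanishing k A n)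
    (h0 : f 0 ∈ vanishing k A 1) : localSum f ∈ vanishing k A 1 := by
  have := add_mem (localSum_sub_mem hf 1) h0
  simpa using this

/-- A map that raises the order of agreement of linear forms vanishing on `𝟏` has at most one fixed
point among them. -/
theorem eq_of_contracting {T : Form k A → Form k A}
    (hT : ∀ n, ∀ x ∈ vanishing k A 1, ∀ y ∈ vanishing k A 1, x - y ∈ vanishing k A n →
      T x - T y ∈ vanishing k A (n + 1)) {x y : Form k A} (hx : x 1 = 0) (hy : y 1 = 0)
    (hTx : T x = x) (hTy : T y = y) : x = y := by
  refine sub_eq_zero.1 (eq_zero_of_forall_mem_vanishing fun n => ?_)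
  induction n with
  | zero => exact mem_vanishing_zero _
  | succ n ih =>
    have := hT n x (mem_vanishing_one.2 hx) y (mem_vanishing_one.2 hy) ih
    rwa [hTx, hTy] at this

/-- A map that raises the order of agreement of linear forms vanishing on `𝟏` has a fixed point
among them: the limit of its iterates. -/
theorem exists_fixedPoint {T : Form k A → Form k A}
    (h1 : ∀ x ∈ vanishing k A 1, T x ∈ vanishing k A 1)
    (hT : ∀ n, ∀ x ∈ vanishing k A 1, ∀ y ∈ vanishing k A 1, x - y ∈ vanishing k A n →
      T x - T y ∈ vanishing k A (n + 1)) : ∃ x : Form k A, x 1 = 0 ∧ T x = x := by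
  have hg1 : ∀ n, T^[n] 0 ∈ vanishing k A 1 := fun n => by
    induction n with
    | zero => exact zero_mem _
    | succ n ih => rw [Function.iterate_succ_apply']; exact h1 _ ih
  have hd : ∀ n, T^[n + 1] 0 - T^[n] 0 ∈ vanishing k A n := fun n => by
    induction n with
    | zero => exact mem_vanishing_zero _
    | succ n ih =>
      have := hT n _ (hg1 (n + 1)) _ (hg1 n) ih
      rwa [← Function.iterate_succ_apply' T, ← Function.iterate_succ_apply' T] at this
  have hs := localSum_sub_mem hd
  set s := localSum fun n => T^[n + 1] 0 - T^[n] 0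
  simp only [Finset.sum_range_sub (fun n => T^[n] 0), Function.iterate_zero, id, sub_zero] at hs
  have hs1 : s ∈ vanishing k A 1 := by
    have := add_mem (hs 1) (hg1 1)
    rwa [sub_add_cancel] at this
  refine ⟨s, mem_vanishing_one.1 hs1, sub_eq_zero.1 (eq_zero_of_forall_mem_vanishing fun n => ?_)⟩
  have h := hT n s hs1 _ (hg1 n) (hs n)
  rw [← Function.iterate_succ_apply' T] at h
  have := vanishing_anti n.le_succ (sub_mem h (hs (n + 1)))
  rwa [sub_sub_sub_cancel_right] at this

/-! ### Exponentials as fixed points -/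

/-- The sum of the iterated products `r (r (⋯ (r e)))` solves `s = e + r s`. -/
theorem localSum_pow_eq {p : Form k A →ₗ[k] Form k A →ₗ[k] Form k A}
    (hp : ∀ {m n f g}, f ∈ vanishing k A m → g ∈ vanishing k A n → p f g ∈ vanishing k A (m + n))
    {r : Form k A} (hr : r ∈ vanishing k A 1) {Y : ℕ → Form k A}
    (hY : ∀ n, Y n ∈ vanishing k A n) (hYs : ∀ n, Y (n + 1) = p r (Y n)) :
    localSum Y = Y 0 + p r (localSum Y) := by
  refine sub_eq_zero.1 (eq_zero_of_forall_mem_vanishing fun n => vanishing_anti n.le_succ ?_)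
  have h1 := localSum_sub_mem hY (n + 1)
  have h2 := hp hr (localSum_sub_mem hY n)
  rw [add_comm 1] at h2
  have h3 : p r (∑ i ∈ Finset.range n, Y i) + Y 0 = ∑ i ∈ Finset.range (n + 1), Y i := by
    simp only [Finset.sum_range_succ', map_sum, hYs]
  have := sub_mem h1 h2
  rw [← h3, map_sub] at this
  convert this using 1
  abel

/-- The equation `s = e + p r s`, with `r` vanishing on `𝟏`, has at most one solution `s`. -/
theorem eq_of_eq_add_apply {p : Form k A →ₗ[k] Form k A →ₗ[k] Form k A}
    (hp : ∀ {m n f g}, f ∈ vanishing k A m → g ∈ vanishing k A n → p f g ∈ vanishing k A (m + n))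
    {r e s t : Form k A} (hr : r ∈ vanishing k A 1) (hs : s = e + p r s) (ht : t = e + p r t) :
    s = t := by
  have h : s - t = p r (s - t) := by
    rw [map_sub]
    nth_rw 1 [hs, ht]
    abel
  refine sub_eq_zero.1 (eq_zero_of_forall_mem_vanishing fun n => ?_)
  induction n with
  | zero => exact mem_vanishing_zero _
  | succ n ih => rw [h, add_comm n]; exact hp hr ih

/-- If `p r ε = r` for forms `r` vanishing on `𝟏`, the equation `s = ε + p r s` determines `r`. -/
theorem eq_of_eq_counit_add_apply {p : Form k A →ₗ[k] Form k A →ₗ[k] Form k A}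
    (hp : ∀ {m n f g}, f ∈ vanishing k A m → g ∈ vanishing k A n → p f g ∈ vanishing k A (m + n))
    (hpε : ∀ {f}, f 1 = 0 → p f (counit k A) = f) {r r' s : Form k A} (hr : r 1 = 0)
    (hr' : r' 1 = 0) (hs1 : s 1 = 1) (hs : s = counit k A + p r s) (hs' : s = counit k A + p r' s) :
    r = r' := by
  have h0 : p (r - r') s = 0 := by
    rw [map_sub, LinearMap.sub_apply, sub_eq_zero]
    exact add_left_cancel (hs.symm.trans hs')
  have h : r - r' = - p (r - r') (s - counit k A) := by
    rw [map_sub, h0, hpε (by simp [hr, hr']), zero_sub, neg_neg]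
  refine sub_eq_zero.1 (eq_zero_of_forall_mem_vanishing fun n => ?_)
  induction n with
  | zero => exact mem_vanishing_zero _
  | succ n ih => rw [h]; exact neg_mem (hp ih (mem_vanishing_one.2 (by simp [hs1])))

/-- If `T` is a Leibniz-type operator for the product `p`, acting as `L` on the left factor and as
the shift `X n ↦ X (n + 1)` on the right one, the recursion `X (n + 1) = p r (X n) + T (X n)`
unfolds into a binomial sum, by Pascal's rule. -/
theorem pow_eq_sum_choose {V : Type*} [AddCommGroup V] [Module k V] (p : V →ₗ[k] V →ₗ[k] V)
    (T L C : V →ₗ[k] V) (hT : ∀ x y, T (p x y) = p (L x) y + p x (C y)) (r : V) (X : ℕ → V)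
    (hX : ∀ n, X (n + 1) = p r (X n) + T (X n)) (hC : ∀ n, C (X n) = X (n + 1))
    (hT0 : T (X 0) = 0) (n : ℕ) :
    X (n + 1) = ∑ i ∈ Finset.range (n + 1), (n + 1).choose (i + 1) • p (L^[i] r) (X (n - i)) := by
  induction n with
  | zero => simp [hX, hT0]
  | succ n ih =>
    rw [hX (n + 1)]
    nth_rw 2 [ih]
    have h1 : ∑ i ∈ Finset.range (n + 2), (n + 2).choose (i + 1) • p (L^[i] r) (X (n + 1 - i)) =
        ∑ i ∈ Finset.range (n + 2), (n + 1).choose i • p (L^[i] r) (X (n + 1 - i)) +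
        ∑ i ∈ Finset.range (n + 2), (n + 1).choose (i + 1) • p (L^[i] r) (X (n + 1 - i)) := by
      rw [← Finset.sum_add_distrib]
      exact Finset.sum_congr rfl fun i _ => by rw [Nat.choose_succ_succ, add_smul]
    rw [map_sum, h1, Finset.sum_range_succ' _ (n + 1), Finset.sum_range_succ _ (n + 1),
      Nat.choose_succ_self, zero_smul, add_zero, add_right_comm, add_comm (p r (X (n + 1))),
      ← Finset.sum_add_distrib]
    simp only [Nat.choose_zero_right, one_smul, Function.iterate_zero, id, Nat.sub_zero]
    congr 1
    refine Finset.sum_congr rfl fun i hi => ?_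
    have hi' : n + 1 - i = n - i + 1 := by have := Finset.mem_range.1 hi; omega
    rw [map_nsmul, hT, hC, Nat.add_sub_add_right, hi', Function.iterate_succ_apply', smul_add]

/-- If the terms of the series `∑ xₙ` are, from the second on, the Cauchy products of `∑ wₙ` and
`∑ xₙ`, its sum `s` satisfies `s = x₀ + p w s`, where `w = ∑ wₙ`. -/
theorem localSum_cauchy {p : Form k A →ₗ[k] Form k A →ₗ[k] Form k A}
    (hp : ∀ {m n f g}, f ∈ vanishing k A m → g ∈ vanishing k A n → p f g ∈ vanishing k A (m + n))
    {w x : ℕ → Form k A} (hw : ∀ n, w n ∈ vanishing k A (n + 1)) (hx : ∀ n, x n ∈ vanishing k A n)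
    (h : ∀ n, x (n + 1) = ∑ i ∈ Finset.range (n + 1), p (w i) (x (n - i))) :
    localSum x = x 0 + p (localSum w) (localSum x) := by
  refine sub_eq_zero.1 (eq_zero_of_forall_mem_vanishing fun n => ?_)
  have hw' : ∀ n, w n ∈ vanishing k A n := fun n => vanishing_anti n.le_succ (hw n)
  have h1 := vanishing_anti n.le_succ (localSum_sub_mem hx (n + 1))
  rw [Finset.sum_range_succ'] at h1
  simp only [h] at h1
  rw [Finset.sum_range_diag_flip n fun i j => p (w i) (x j)] at h1
  have h2 := hp (localSum_sub_mem hw' n) (mem_vanishing_zero (localSum x))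
  have h3 : ∑ i ∈ Finset.range n, p (w i) (localSum x - ∑ j ∈ Finset.range (n - i), x j) ∈
      vanishing k A n := sum_mem fun i hi =>
    vanishing_anti (by omega) (hp (hw i) (localSum_sub_mem hx (n - i)))
  have := sub_mem (sub_mem h1 h2) h3
  simp only [map_sub, map_sum, Finset.sum_sub_distrib, LinearMap.sub_apply,
    LinearMap.sum_apply] at this
  convert this using 1
  abel

/-! ### The terms of the series -/

theorem convPow_mem {f : Form k A} (hf : f 1 = 0) (n : ℕ) : convPow f n ∈ vanishing k A n := by
  induction n with
  | zero => exact mem_vanishing_zero _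
  | succ n ih => rw [convPow, add_comm n]; exact conv_mem (mem_vanishing_one.2 hf) ih

theorem expConvTerm_mem {f : Form k A} (hf : f 1 = 0) (n : ℕ) :
    expConvTerm f n ∈ vanishing k A n :=
  Submodule.smul_mem _ _ (convPow_mem hf n)

theorem precPow_mem {f : Form k A} (hf : f 1 = 0) (n : ℕ) : precPow f n ∈ vanishing k A n := by
  induction n with
  | zero => exact mem_vanishing_zero _
  | succ n ih => rw [precPow, add_comm n]; exact prec_mem (mem_vanishing_one.2 hf) ih

theorem succPow_mem {f : Form k A} (hf : f 1 = 0) (n : ℕ) : succPow f n ∈ vanishing k A n := by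
  induction n with
  | zero => exact mem_vanishing_zero _
  | succ n ih => exact succ_mem ih (mem_vanishing_one.2 hf)

theorem preLie_iterate_mem {f g : Form k A} {m : ℕ} (hf : f 1 = 0) (hg : g ∈ vanishing k A m)
    (n : ℕ) : (preLie f)^[n] g ∈ vanishing k A (n + m) := by
  induction n with
  | zero => simpa using hg
  | succ n ih =>
    rw [Function.iterate_succ_apply']
    have := preLie_mem (mem_vanishing_one.2 hf) ih
    rwa [← add_assoc, add_comm 1] at this

theorem WTerm_mem {f : Form k A} (hf : f 1 = 0) (n : ℕ) : WTerm f n ∈ vanishing k A (n + 1) :=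
  Submodule.smul_mem _ _ (preLie_iterate_mem hf (mem_vanishing_one.2 hf) n)

theorem WTerm_mem' {f : Form k A} (hf : f 1 = 0) (n : ℕ) : WTerm f n ∈ vanishing k A n :=
  vanishing_anti n.le_succ (WTerm_mem hf n)

theorem magnusTerm_mem {f ω : Form k A} (hω : ω 1 = 0) (n : ℕ) :
    magnusTerm ω f n ∈ vanishing k A n :=
  Submodule.smul_mem _ _ (preLie_iterate_mem hω (mem_vanishing_zero f) n)

theorem W_apply_one {f : Form k A} (hf : f 1 = 0) : W f 1 = 0 :=
  mem_vanishing_one.1 (localSum_mem_one (WTerm_mem' hf) (WTerm_mem hf 0))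

/-! ### The shuffle exponential as a half-shuffle exponential -/

theorem convPow_succ' (f : Form k A) (n : ℕ) : conv (convPow f n) f = convPow f (n + 1) := by
  induction n with
  | zero => simp only [convPow, conv_counit, counit_conv]
  | succ n ih => rw [convPow, conv_assoc, ih]; rfl

/-- The operator `g ↦ ρ ≻ g` satisfies a Leibniz rule for `≺`, with `L_{ρ ▷}` acting on the left
factor and convolution by `ρ` on the right one. -/
theorem succ_prec_leibniz (ρ x y : Form k A) :
    succ ρ (prec x y) = prec (preLie ρ x) y + prec x (conv ρ y) := by
  rw [← succ_prec, ← prec_prec]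
  simp only [← precBilin_apply, ← LinearMap.add_apply, ← map_add]
  simp [preLie, precBilin_apply]

/-- The mirror image of `succ_prec_leibniz`. -/
theorem prec_succ_leibniz (ρ x y : Form k A) :
    prec (succ y x) ρ = succ y (preLie (-ρ) x) + succ (conv y ρ) x := by
  rw [succ_prec, succ_succ]
  simp only [← succBilin_apply, ← map_add]
  rw [← preLieBilin_apply, map_neg, LinearMap.neg_apply, preLieBilin_apply, preLie]
  simp [succBilin_apply]

theorem inv_factorial_mul_choose [CharZero k] {n i : ℕ} (hi : i < n + 1) :
    ((n + 1).factorial : k)⁻¹ * ((n + 1).choose (i + 1) : k) =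
      ((i + 1).factorial : k)⁻¹ * ((n - i).factorial : k)⁻¹ := by
  have h := Nat.choose_mul_factorial_mul_factorial (Nat.succ_le_of_lt hi)
  rw [Nat.succ_eq_add_one, Nat.add_sub_add_right] at h
  have h' := congrArg (Nat.cast : ℕ → k) h
  push_cast at h'
  have h1 : ((n + 1).factorial : k) ≠ 0 := Nat.cast_ne_zero.2 (Nat.factorial_ne_zero _)
  have h2 : ((i + 1).factorial : k) ≠ 0 := Nat.cast_ne_zero.2 (Nat.factorial_ne_zero _)
  have h3 : ((n - i).factorial : k) ≠ 0 := Nat.cast_ne_zero.2 (Nat.factorial_ne_zero _)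
  field_simp
  linear_combination h'

/-- The form `exp^*(ρ)` solves the fixed point equation of `exp^≺(W(ρ))`. -/
theorem expConv_eq_prec [CharZero k] {ρ : Form k A} (hρ : ρ 1 = 0) :
    expConv ρ = counit k A + prec (W ρ) (expConv ρ) := by
  have key := localSum_cauchy (p := precBilin k A) prec_mem (WTerm_mem hρ) (expConvTerm_mem hρ)
    fun n => by
      have h := pow_eq_sum_choose (precBilin k A) (succBilin k A ρ) (preLieBilin k A ρ)
        (convBilin k A ρ) (succ_prec_leibniz ρ) ρ (convPow ρ)
        (fun n => conv_eq_prec_add_succ (by simp [hρ])) (fun n => rfl) (succ_counit ρ) n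
      rw [expConvTerm, h, Finset.smul_sum]
      refine Finset.sum_congr rfl fun i hi => ?_
      rw [← Nat.cast_smul_eq_nsmul k, smul_smul, inv_factorial_mul_choose (Finset.mem_range.1 hi),
        WTerm, expConvTerm, map_smul, map_smul, LinearMap.smul_apply, smul_smul, mul_comm]
      rfl
  simpa [expConvTerm, convPow, W, expConv, precBilin_apply] using key

theorem succ_flip_mem {m n : ℕ} {f g : Form k A} (hf : f ∈ vanishing k A m)
    (hg : g ∈ vanishing k A n) : (succBilin k A).flip f g ∈ vanishing k A (m + n) :=
  add_comm n m ▸ succ_mem hg hf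

theorem HasLocalSum.neg {f : ℕ → Form k A} {s : Form k A} (h : HasLocalSum f s) :
    HasLocalSum (fun n => -f n) (-s) := fun x => by
  obtain ⟨N, hN⟩ := h x
  exact ⟨N, fun n hn => by simp [← hN n hn]⟩

/-- The form `exp^*(ρ)` solves the fixed point equation of `exp^≻(-W(-ρ))`. -/
theorem expConv_eq_succ [CharZero k] {ρ : Form k A} (hρ : ρ 1 = 0) :
    expConv ρ = counit k A + succ (expConv ρ) (-W (-ρ)) := by
  have hρ' : (-ρ) 1 = 0 := by simp [hρ]
  have key := localSum_cauchy (p := (succBilin k A).flip) (w := fun n => -WTerm (-ρ) n)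
    (x := expConvTerm ρ) succ_flip_mem (fun n => neg_mem (WTerm_mem hρ' n))
    (expConvTerm_mem hρ) fun n => by
      have h := pow_eq_sum_choose (succBilin k A).flip ((precBilin k A).flip ρ)
        (preLieBilin k A (-ρ)) ((convBilin k A).flip ρ) (prec_succ_leibniz ρ) ρ (convPow ρ)
        (fun n => by
          rw [← convPow_succ', conv_eq_prec_add_succ (by simp [hρ]), add_comm]; rfl)
        (convPow_succ' ρ) (counit_prec ρ) n
      rw [expConvTerm, h, Finset.smul_sum]
      refine Finset.sum_congr rfl fun i hi => ?_
      rw [← Nat.cast_smul_eq_nsmul k, smul_smul, inv_factorial_mul_choose (Finset.mem_range.1 hi),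
        WTerm, expConvTerm, ← coe_preLieBilin, iterate_map_neg, smul_neg, neg_neg, map_smul,
        map_smul, LinearMap.smul_apply, smul_smul, mul_comm]
  rw [(hasLocalSum_localSum (WTerm_mem' hρ')).neg.localSum_eq] at key
  simpa [expConvTerm, convPow, W, expConv, ← succBilin_apply] using key

theorem expPrec_eq {f : Form k A} (hf : f 1 = 0) :
    expPrec f = counit k A + prec f (expPrec f) :=
  localSum_pow_eq (p := precBilin k A) prec_mem (mem_vanishing_one.2 hf) (precPow_mem hf)
    fun _ => rfl

theorem expSucc_eq {f : Form k A} (hf : f 1 = 0) :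
    expSucc f = counit k A + succ (expSucc f) f :=
  localSum_pow_eq (p := (succBilin k A).flip) succ_flip_mem (mem_vanishing_one.2 hf)
    (succPow_mem hf) fun _ => rfl

theorem eq_expPrec {f s : Form k A} (hf : f 1 = 0) (hs : s = counit k A + prec f s) :
    s = expPrec f :=
  eq_of_eq_add_apply (p := precBilin k A) prec_mem (mem_vanishing_one.2 hf) hs (expPrec_eq hf)

theorem eq_expSucc {f s : Form k A} (hf : f 1 = 0) (hs : s = counit k A + succ s f) :
    s = expSucc f :=
  eq_of_eq_add_apply (p := (succBilin k A).flip) succ_flip_mem (mem_vanishing_one.2 hf) hs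
    (expSucc_eq hf)

theorem prec_right_injective {r r' s : Form k A} (hr : r 1 = 0) (hr' : r' 1 = 0) (hs1 : s 1 = 1)
    (hs : s = counit k A + prec r s) (hs' : s = counit k A + prec r' s) : r = r' :=
  eq_of_eq_counit_add_apply (p := precBilin k A) prec_mem prec_counit hr hr' hs1 hs hs'

theorem succ_left_injective {r r' s : Form k A} (hr : r 1 = 0) (hr' : r' 1 = 0) (hs1 : s 1 = 1)
    (hs : s = counit k A + succ s r) (hs' : s = counit k A + succ s r') : r = r' :=
  eq_of_eq_counit_add_apply (p := (succBilin k A).flip) succ_flip_mem counit_succ hr hr' hs1 hs hs'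

/-! ### The pre-Lie Magnus expansion is inverse to `W` -/

/-- If `∑ aₙ tⁿ` and `∑ bₙ tⁿ` are inverse power series and the operator `L` raises degrees, then
`y = ∑ bₙ Lⁿ x` implies `x = ∑ aₙ Lⁿ y`. -/
theorem hasLocalSum_inverse {a b : ℕ → k}
    (hab : ∀ n, ∑ i ∈ Finset.range (n + 1), a i * b (n - i) = if n = 0 then 1 else 0)
    {L : Form k A →ₗ[k] Form k A} (hL : ∀ n, ∀ f ∈ vanishing k A n, L f ∈ vanishing k A (n + 1))
    {x y : Form k A} (h : HasLocalSum (fun n => b n • L^[n] x) y) :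
    HasLocalSum (fun n => a n • L^[n] y) x := by
  have hLn : ∀ m n, ∀ f ∈ vanishing k A m, L^[n] f ∈ vanishing k A (n + m) := fun m n f hf => by
    induction n with
    | zero => simpa using hf
    | succ n ih =>
      rw [Function.iterate_succ_apply', Nat.add_right_comm]
      exact hL _ _ ih
  have hmem : ∀ (c : ℕ → k) (f : Form k A) n, c n • L^[n] f ∈ vanishing k A n := fun c f n =>
    Submodule.smul_mem _ _ (hLn 0 n f (mem_vanishing_zero f))
  rw [hasLocalSum_iff (hmem b x)] at h
  refine (hasLocalSum_iff (hmem a y)).2 fun N => ?_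
  have h1 : ∑ n ∈ Finset.range N,
      a n • L^[n] (y - ∑ i ∈ Finset.range (N - n), b i • L^[i] x) ∈ vanishing k A N :=
    sum_mem fun n hn => Submodule.smul_mem _ _ <|
      vanishing_anti (by have := Finset.mem_range.1 hn; omega) (hLn _ n _ (h (N - n)))
  have h2 : ∑ n ∈ Finset.range N, a n • L^[n] (∑ i ∈ Finset.range (N - n), b i • L^[i] x) =
      if N = 0 then 0 else x := by
    simp only [← Module.End.pow_apply, map_sum, map_smul, Finset.smul_sum, smul_smul]
    simp only [← Module.End.mul_apply, ← pow_add]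
    have e := Finset.sum_range_diag_flip N fun n i => (a n * b i) • (L ^ (n + i)) x
    rw [← e]
    have e' : ∀ m, ∑ i ∈ Finset.range (m + 1), (a i * b (m - i)) • (L ^ (i + (m - i))) x =
        if m = 0 then x else 0 := fun m => by
      rw [Finset.sum_congr rfl fun i hi => by
        rw [Nat.add_sub_cancel' (Nat.lt_succ_iff.1 (Finset.mem_range.1 hi))], ← Finset.sum_smul,
        hab]
      split_ifs with hm <;> simp [hm]
    simp only [e']
    cases N <;> simp
  simp only [← Module.End.pow_apply, map_sub, smul_sub, Finset.sum_sub_distrib] at h1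
  simp only [← Module.End.pow_apply] at h2 ⊢
  rw [h2] at h1
  split_ifs at h1 with hN
  · subst hN; exact mem_vanishing_zero _
  · simpa using neg_mem h1

theorem sum_bernoulli_mul [CharZero k] (n : ℕ) :
    ∑ i ∈ Finset.range (n + 1), ((bernoulli i : ℚ) : k) * (i.factorial : k)⁻¹ *
      ((n - i + 1).factorial : k)⁻¹ = if n = 0 then 1 else 0 := by
  have h := bernoulli_spec' n
  rw [Finset.Nat.sum_antidiagonal_eq_sum_range_succ_mk] at h
  have h' := congrArg (fun q : ℚ => (q : k) * (n.factorial : k)⁻¹) h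
  simp only [Rat.cast_sum, Finset.sum_mul] at h'
  have e : (((if n = 0 then 1 else 0 : ℚ)) : k) * (n.factorial : k)⁻¹ =
      if n = 0 then 1 else 0 := by
    split_ifs with h0 <;> simp [h0]
  rw [e] at h'
  rw [← h']
  refine Finset.sum_congr rfl fun i hi => ?_
  have hi : i ≤ n := Nat.lt_succ_iff.1 (Finset.mem_range.1 hi)
  have hc := Nat.choose_mul_factorial_mul_factorial (Nat.sub_le n i)
  rw [Nat.sub_sub_self hi] at hc
  have hc' := congrArg (Nat.cast : ℕ → k) hc
  push_cast at hc'
  have h1 : (n.factorial : k) ≠ 0 := Nat.cast_ne_zero.2 (Nat.factorial_ne_zero _)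
  have h2 : (i.factorial : k) ≠ 0 := Nat.cast_ne_zero.2 (Nat.factorial_ne_zero _)
  have h3 : ((n - i).factorial : k) ≠ 0 := Nat.cast_ne_zero.2 (Nat.factorial_ne_zero _)
  have h4 : ((n - i : ℕ) : k) + 1 ≠ 0 := Nat.cast_add_one_ne_zero _
  simp only [Nat.add_sub_cancel' hi, Nat.factorial_succ]
  push_cast
  field_simp
  linear_combination -((bernoulli i : ℚ) : k) * hc'

theorem sum_mul_bernoulli [CharZero k] (n : ℕ) :
    ∑ i ∈ Finset.range (n + 1), ((i + 1).factorial : k)⁻¹ *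
      (((bernoulli (n - i) : ℚ) : k) * ((n - i).factorial : k)⁻¹) = if n = 0 then 1 else 0 := by
  rw [← sum_bernoulli_mul, ← Finset.sum_range_reflect]
  refine Finset.sum_congr rfl fun i hi => ?_
  have hi : i ≤ n := Nat.lt_succ_iff.1 (Finset.mem_range.1 hi)
  rw [Nat.add_sub_cancel, Nat.sub_sub_self hi, mul_comm]

theorem preLieBilin_mem {ω : Form k A} (hω : ω 1 = 0) (n : ℕ) (f : Form k A)
    (hf : f ∈ vanishing k A n) : preLieBilin k A ω f ∈ vanishing k A (n + 1) :=
  add_comm 1 n ▸ preLie_mem (mem_vanishing_one.2 hω) hf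

theorem IsMagnus.W_eq [CharZero k] {f ω : Form k A} (h : IsMagnus f ω) : W ω = f :=
  (hasLocalSum_inverse (L := preLieBilin k A ω) sum_mul_bernoulli (preLieBilin_mem h.1)
    h.2).localSum_eq

theorem isMagnus_W [CharZero k] {f : Form k A} (hf : f 1 = 0) : IsMagnus (W f) f :=
  ⟨hf, hasLocalSum_inverse (L := preLieBilin k A f) sum_bernoulli_mul (preLieBilin_mem hf)
    (hasLocalSum_localSum (WTerm_mem' hf))⟩

theorem localSum_magnusTerm_mem {f : Form k A} (hf : f 1 = 0) {ω : Form k A}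
    (hω : ω ∈ vanishing k A 1) : localSum (magnusTerm ω f) ∈ vanishing k A 1 :=
  localSum_mem_one (magnusTerm_mem (mem_vanishing_one.1 hω))
    (Submodule.smul_mem _ _ (mem_vanishing_one.2 hf))

theorem localSum_magnusTerm_contracting {f : Form k A} (hf : f 1 = 0) (n : ℕ) (x : Form k A)
    (hx : x ∈ vanishing k A 1) (y : Form k A) (hy : y ∈ vanishing k A 1)
    (hxy : x - y ∈ vanishing k A n) :
    localSum (magnusTerm x f) - localSum (magnusTerm y f) ∈ vanishing k A (n + 1) := by
  rw [mem_vanishing_one] at hx hy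
  have key : ∀ m, (preLie x)^[m] f - (preLie y)^[m] f ∈ vanishing k A (n + 1) := fun m => by
    induction m with
    | zero => simp
    | succ m ih =>
      have h1 := preLie_mem (mem_vanishing_zero x) ih
      have h2 := preLie_mem hxy
        (vanishing_anti (Nat.le_add_left 1 m) (preLie_iterate_mem hy (mem_vanishing_one.2 hf) m))
      rw [zero_add] at h1
      have := add_mem h1 h2
      rw [Function.iterate_succ_apply', Function.iterate_succ_apply']
      simpa only [← preLieBilin_apply, map_sub, LinearMap.sub_apply, sub_add_sub_cancel] using this
  have h1 := localSum_sub_mem (magnusTerm_mem (f := f) hx) (n + 1)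
  have h2 := localSum_sub_mem (magnusTerm_mem (f := f) hy) (n + 1)
  have h3 : ∑ i ∈ Finset.range (n + 1), magnusTerm x f i -
      ∑ i ∈ Finset.range (n + 1), magnusTerm y f i ∈ vanishing k A (n + 1) := by
    rw [← Finset.sum_sub_distrib]
    refine sum_mem fun i _ => ?_
    have := Submodule.smul_mem _ (((bernoulli i : ℚ) : k) * (i.factorial : k)⁻¹) (key i)
    rwa [smul_sub] at this
  have := add_mem (sub_mem h1 h2) h3
  convert this using 1
  abel

theorem isMagnus_iff {f ω : Form k A} :
    IsMagnus f ω ↔ ω 1 = 0 ∧ localSum (magnusTerm ω f) = ω := by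
  refine and_congr_right fun h => ⟨fun h' => h'.localSum_eq, fun h' => ?_⟩
  have := hasLocalSum_localSum (magnusTerm_mem (f := f) h)
  rwa [h'] at this

theorem IsMagnus.unique {f ω ω' : Form k A} (hf : f 1 = 0) (h : IsMagnus f ω)
    (h' : IsMagnus f ω') : ω = ω' :=
  eq_of_contracting (localSum_magnusTerm_contracting hf) h.1 h'.1 (isMagnus_iff.1 h).2
    (isMagnus_iff.1 h').2

theorem isMagnus_magnus {f : Form k A} (hf : f 1 = 0) : IsMagnus f (magnus f) := by
  obtain ⟨ω, h⟩ := exists_fixedPoint (fun _ => localSum_magnusTerm_mem hf)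
    (localSum_magnusTerm_contracting hf)
  have h : ∃ ω, IsMagnus f ω := ⟨ω, isMagnus_iff.2 h⟩
  rw [magnus, dif_pos h]
  exact h.choose_spec

theorem W_magnus [CharZero k] {f : Form k A} (hf : f 1 = 0) : W (magnus f) = f :=
  (isMagnus_magnus hf).W_eq

theorem magnus_W [CharZero k] {f : Form k A} (hf : f 1 = 0) : magnus (W f) = f :=
  (isMagnus_magnus (W_apply_one hf)).unique (W_apply_one hf) (isMagnus_W hf)

/-! ### Infinitesimal characters -/

theorem IsInfinitesimal.apply_mul {f : Form k A} (hf : IsInfinitesimal f) (x : DoubleTensor k A)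
    {y : DoubleTensor k A} (hy : counit k A y = 0) : f (x * y) = counit k A x * f y := by
  have h := hf.2 (x - counit k A x • 1) y (by simp) hy
  rw [sub_mul, smul_mul_assoc, one_mul, map_sub, map_smul, sub_eq_zero] at h
  exact h

theorem isInfinitesimal_iff {f : Form k A} : IsInfinitesimal f ↔
    f 1 = 0 ∧ ∀ a l x, f (wd k (a :: l) * x) = f (wd k (a :: l)) * counit k A x := by
  refine and_congr_right fun h1 => ⟨fun h a l x => ?_, fun h x y hx hy => ?_⟩
  · have := h (wd k (a :: l)) (x - counit k A x • 1) (by simp) (by simp)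
    rw [mul_sub, mul_smul_comm, mul_one, map_sub, map_smul, sub_eq_zero] at this
    rw [this, smul_eq_mul, mul_comm]
  · have key : f ∘ₗ LinearMap.mulRight k y = f y • counit k A := by
      refine linear_ext_cons (by simp) fun a l ws => ?_
      simp [mul_assoc, h, hy]
    have := LinearMap.congr_fun key x
    simpa [hx] using this

/-- The infinitesimal character with the same values on `T(A)` as `f`. It is the `ε`-component of
the algebra morphism to the dual numbers with `w ↦ f(w) ε` for `w ∈ T(A)`. -/
def infPart (f : Form k A) : Form k A :=
  TrivSqZeroExt.sndHom k k ∘ₗ (TensorAlgebra.lift k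
    (TrivSqZeroExt.inrHom k k ∘ₗ f ∘ₗ TensorAlgebra.ι k)).toLinearMap

theorem infPart_wd_mul (f : Form k A) (a : A) (l : List A) (x : DoubleTensor k A) :
    infPart f (wd k (a :: l) * x) = f (wd k (a :: l)) * counit k A x := by
  have h : (TrivSqZeroExt.fstHom k k k).comp (TensorAlgebra.lift k
      (TrivSqZeroExt.inrHom k k ∘ₗ f ∘ₗ TensorAlgebra.ι k)) = TensorAlgebra.algebraMapInv := by
    ext x
    simp [TensorAlgebra.algebraMapInv]
  have hx := AlgHom.congr_fun h x
  simp only [AlgHom.comp_apply, TrivSqZeroExt.fstHom_apply] at hx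
  simp [infPart, wd_cons, hx, counit, mul_comm]

theorem isInfinitesimal_infPart (f : Form k A) : IsInfinitesimal (infPart f) := by
  refine isInfinitesimal_iff.2 ⟨by simp [infPart], fun a l x => ?_⟩
  have := infPart_wd_mul f a l 1
  rw [mul_one, counit_one, mul_one] at this
  rw [infPart_wd_mul, this]

theorem IsInfinitesimal.infPart_eq {f : Form k A} (hf : IsInfinitesimal f) : infPart f = f := by
  refine linear_ext_cons ?_ fun a l ws => ?_
  · rw [hf.1, (isInfinitesimal_infPart f).1]
  · rw [infPart_wd_mul, (isInfinitesimal_iff.1 hf).2]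

theorem infPart_sub_mem {f g : Form k A} {n : ℕ} (h : f - g ∈ vanishing k A n) :
    infPart f - infPart g ∈ vanishing k A n := by
  refine mem_vanishing_of_cons (fun _ => ?_) fun a l ws hl => ?_
  · simp [(isInfinitesimal_infPart f).1, (isInfinitesimal_infPart g).1]
  · have hl' : [a :: l].flatten.length < n := by
      simp only [List.flatten_cons, List.flatten_nil, List.append_nil, List.length_cons]
      omega
    have := h _ hl'
    rw [bar_cons, bar_nil, mul_one, LinearMap.sub_apply] at this
    rw [LinearMap.sub_apply, infPart_wd_mul, infPart_wd_mul, ← sub_mul, this, zero_mul]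

theorem IsInfinitesimal.smul {f : Form k A} (hf : IsInfinitesimal f) (c : k) :
    IsInfinitesimal (c • f) :=
  ⟨by simp [hf.1], fun x y hx hy => by simp [hf.2 x y hx hy]⟩

theorem HasLocalSum.isInfinitesimal {f : ℕ → Form k A} {s : Form k A} (hs : HasLocalSum f s)
    (hf : ∀ n, IsInfinitesimal (f n)) : IsInfinitesimal s := by
  have key : ∀ x, (∀ n, f n x = 0) → s x = 0 := fun x hx => by
    obtain ⟨N, hN⟩ := hs x
    rw [← hN N le_rfl, Finset.sum_eq_zero fun i _ => hx i]
  exact ⟨key _ fun n => (hf n).1, fun x y hx hy => key _ fun n => (hf n).2 x y hx hy⟩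

/-- A counit on the words kept after the first bar forces all letters after that bar to be
removed. -/
theorem cosum_counit_kept (g : Form k A) (X : List A → k) (Y : List A → DoubleTensor k A)
    (l : List A) (ws : List (List A)) :
    (cosum l ws fun s ss u us => X s * counit k A (bar k ss) * g (Y u * bar k us)) =
      cosum l [] fun s _ u us => X s * g (Y u * bar k us * bar k ws) := by
  induction l, ws using barWord_induction generalizing X Y with
  | nil => simp [cosum]
  | bar w ws ih =>
    simp only [cosum, mul_assoc, bar_cons, ← mul_cosum]
    have := cosum_counit_left g (fun u => Y [] * wd k u) w ws
    simp only [mul_assoc] at this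
    rw [this, bar_nil, one_mul]
  | letter a l ws ih =>
    simp only [cosum, bar_cons]
    have := ih (fun s => X (a :: s)) fun u => Y [] * wd k u
    simp only [mul_assoc] at this ih ⊢
    rw [this, ih X fun u => Y (a :: u)]

/-- A counit on the words removed after the first one forces all letters after the first bar to be
kept. -/
theorem cosum_counit_removed (f : Form k A) (X : List A → DoubleTensor k A) (Z : List A → k)
    (l : List A) (ws : List (List A)) :
    (cosum l ws fun s ss u us => f (X s * bar k ss) * (Z u * counit k A (bar k us))) =
      cosum l [] fun s _ u us => f (X s * bar k ws) * (Z u * counit k A (bar k us)) := by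
  induction l, ws using barWord_induction generalizing X Z with
  | nil => simp [cosum]
  | bar w ws ih =>
    have := cosum_counit_right f (fun s => X [] * wd k s) w ws
    simp only [mul_assoc] at this
    simp only [cosum, bar_cons, mul_left_comm (f _), ← mul_cosum, this, bar_nil, counit_one,
      mul_one]
  | letter a l ws ih =>
    simp only [cosum, bar_cons, counit_mul]
    have := ih (fun s => X (a :: s)) fun u => Z [] * counit k A (wd k u)
    simp only [mul_assoc] at this ih ⊢
    rw [this, ih X fun u => Z (a :: u)]

theorem IsInfinitesimal.prec_bar {f : Form k A} (hf : IsInfinitesimal f) (g : Form k A) (a : A)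
    (l : List A) (ws : List (List A)) : prec f g (wd k (a :: l) * bar k ws) =
      cosum l [] fun s _ u us => f (wd k (a :: s)) * g (wd k u * bar k us * bar k ws) := by
  rw [CumulantShuffle.prec_bar]
  simp only [(isInfinitesimal_iff.1 hf).2]
  exact cosum_counit_kept g (fun s => f (wd k (a :: s))) (wd k) l ws

theorem IsInfinitesimal.succ_bar {g : Form k A} (hg : IsInfinitesimal g) (f : Form k A) (a : A)
    (l : List A) (ws : List (List A)) : succ f g (wd k (a :: l) * bar k ws) =
      cosum l [] fun s _ u us => f (wd k s * bar k ws) *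
        (g (wd k (a :: u)) * counit k A (bar k us)) := by
  rw [CumulantShuffle.succ_bar]
  simp only [(isInfinitesimal_iff.1 hg).2]
  exact cosum_counit_removed f (wd k) (fun u => g (wd k (a :: u))) l ws

theorem IsInfinitesimal.prec_algHom {f : Form k A} (hf : IsInfinitesimal f)
    (Φ : DoubleTensor k A →ₐ[k] k) (a : A) (l : List A) (ws : List (List A)) :
    prec f Φ.toLinearMap (wd k (a :: l) * bar k ws) =
      prec f Φ.toLinearMap (wd k (a :: l)) * Φ (bar k ws) := by
  have h := hf.prec_bar Φ.toLinearMap a l []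
  rw [bar_nil, mul_one] at h
  rw [h, hf.prec_bar, cosum_mul]
  simp [mul_assoc]

theorem IsInfinitesimal.succ_algHom {f : Form k A} (hf : IsInfinitesimal f)
    (Φ : DoubleTensor k A →ₐ[k] k) (a : A) (l : List A) (ws : List (List A)) :
    succ Φ.toLinearMap f (wd k (a :: l) * bar k ws) =
      succ Φ.toLinearMap f (wd k (a :: l)) * Φ (bar k ws) := by
  have h := hf.succ_bar Φ.toLinearMap a l []
  rw [bar_nil, mul_one] at h
  rw [h, hf.succ_bar, cosum_mul]
  simp [mul_comm, mul_left_comm]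

/-- On `w | x` with `x` in the augmentation ideal both `f ≻ g` and `g ≺ f` take the value
`g(w) f(x)`, so that the pre-Lie product of infinitesimal characters is infinitesimal. -/
theorem IsInfinitesimal.preLie {f g : Form k A} (hf : IsInfinitesimal f)
    (hg : IsInfinitesimal g) : IsInfinitesimal (preLie f g) := by
  have key : ∀ a l ws, counit k A (bar k ws) = 0 →
      CumulantShuffle.preLie f g (wd k (a :: l) * bar k ws) = 0 := fun a l ws hw => by
    have h1 : succ f g (wd k (a :: l) * bar k ws) = f (bar k ws) * g (wd k (a :: l)) := by
      have h := hg.succ_bar (counit k A) a l []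
      rw [counit_succ hg.1, bar_nil, mul_one] at h
      rw [h, hg.succ_bar, mul_cosum]
      simp [hf.apply_mul _ hw, mul_comm, mul_left_comm]
    have h2 : prec g f (wd k (a :: l) * bar k ws) = g (wd k (a :: l)) * f (bar k ws) := by
      have h := hg.prec_bar (counit k A) a l []
      rw [prec_counit hg.1, bar_nil, mul_one] at h
      rw [h, hg.prec_bar, cosum_mul]
      simp only [hf.apply_mul _ hw]
      simp only [mul_assoc, mul_one]
    rw [CumulantShuffle.preLie, LinearMap.sub_apply, h1, h2, mul_comm, sub_self]
  refine isInfinitesimal_iff.2 ⟨by simp [CumulantShuffle.preLie], fun a l x => ?_⟩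
  have : CumulantShuffle.preLie f g ∘ₗ LinearMap.mulLeft k (wd k (a :: l)) =
      CumulantShuffle.preLie f g (wd k (a :: l)) • counit k A := by
    refine linear_ext_cons (by simp) fun b m ws => ?_
    have := key a l ((b :: m) :: ws) (by simp)
    rw [bar_cons] at this
    simp [this]
  exact LinearMap.congr_fun this x

theorem IsInfinitesimal.preLie_iterate {f g : Form k A} (hf : IsInfinitesimal f)
    (hg : IsInfinitesimal g) (n : ℕ) : IsInfinitesimal ((CumulantShuffle.preLie f)^[n] g) := by
  induction n with
  | zero => exact hg
  | succ n ih => rw [Function.iterate_succ_apply']; exact hf.preLie ih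

theorem infPart_mem {f : Form k A} : infPart f ∈ vanishing k A 1 :=
  mem_vanishing_one.2 (isInfinitesimal_infPart f).1

theorem IsInfinitesimal.magnus {f : Form k A} (hf : IsInfinitesimal f) :
    IsInfinitesimal (magnus f) := by
  -- the fixed point is sought among the infinitesimal characters, by composing with `infPart`
  obtain ⟨ω, hω1, hω⟩ := exists_fixedPoint (T := fun ω => infPart (localSum (magnusTerm ω f)))
    (fun _ _ => infPart_mem) fun n x hx y hy h =>
      infPart_sub_mem (localSum_magnusTerm_contracting hf.1 n x hx y hy h)
  have hi : IsInfinitesimal ω := hω ▸ isInfinitesimal_infPart _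
  have hs : IsInfinitesimal (localSum (magnusTerm ω f)) :=
    (hasLocalSum_localSum (magnusTerm_mem hω1)).isInfinitesimal fun n =>
      (hi.preLie_iterate hf n).smul _
  have hm : IsMagnus f ω := isMagnus_iff.2 ⟨hω1, hs.infPart_eq.symm.trans hω⟩
  rwa [(isMagnus_magnus hf.1).unique hf.1 hm]

/-! ### Cumulants -/

/-- For a character `Φ` and a half-shuffle product `p`, the restriction to words of the equation
`Φ = ε + p κ Φ` can be solved by an infinitesimal character `κ`; both sides being multiplicative,
the equation then holds on `H`. -/
theorem exists_infinitesimal {p : Form k A →ₗ[k] Form k A →ₗ[k] Form k A}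
    (hp : ∀ {m n f g}, f ∈ vanishing k A m → g ∈ vanishing k A n → p f g ∈ vanishing k A (m + n))
    (hpε : ∀ {f}, f 1 = 0 → p f (counit k A) = f) (hp1 : ∀ f g, p f g 1 = 0)
    (Φ : DoubleTensor k A →ₐ[k] k)
    (hmul : ∀ {f}, IsInfinitesimal f → ∀ a l ws, p f Φ.toLinearMap (wd k (a :: l) * bar k ws) =
      p f Φ.toLinearMap (wd k (a :: l)) * Φ (bar k ws)) :
    ∃ κ, IsInfinitesimal κ ∧ Φ.toLinearMap = counit k A + p κ Φ.toLinearMap := by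
  have hΦ : Φ.toLinearMap - counit k A ∈ vanishing k A 1 := mem_vanishing_one.2 (by simp)
  obtain ⟨κ, hκ1, hκ⟩ := exists_fixedPoint
    (T := fun κ => infPart (Φ.toLinearMap - counit k A - p κ (Φ.toLinearMap - counit k A)))
    (fun _ _ => infPart_mem) fun n x hx y hy h => infPart_sub_mem (by
      have := neg_mem (hp h hΦ)
      rw [map_sub p, LinearMap.sub_apply] at this
      convert this using 1
      abel)
  have hi : IsInfinitesimal κ := hκ ▸ isInfinitesimal_infPart _
  refine ⟨κ, hi, linear_ext_cons (by simp [hp1]) fun a l ws => ?_⟩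
  have hw : κ (wd k (a :: l)) = Φ (wd k (a :: l)) -
      (p κ Φ.toLinearMap (wd k (a :: l)) - κ (wd k (a :: l))) := by
    conv_lhs => rw [← hκ, ← mul_one (wd k (a :: l)), infPart_wd_mul]
    rw [map_sub, hpε hκ1]
    simp
  have hw' : Φ (wd k (a :: l)) = p κ Φ.toLinearMap (wd k (a :: l)) := by
    linear_combination -hw
  rw [LinearMap.add_apply, hmul hi, ← hw']
  simp

theorem exists_isFreeCumulant (φ : A →ₗ[k] k) : ∃ κ : Form k A, IsFreeCumulant φ κ :=
  exists_infinitesimal (p := precBilin k A) prec_mem prec_counit prec_one (momentCharacter φ)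
    fun hf => hf.prec_algHom _

theorem exists_isBooleanCumulant (φ : A →ₗ[k] k) : ∃ β : Form k A, IsBooleanCumulant φ β :=
  exists_infinitesimal (p := (succBilin k A).flip) succ_flip_mem counit_succ
    (fun f g => succ_one g f) (momentCharacter φ) fun hf => hf.succ_algHom _

theorem IsFreeCumulant.eq {φ : A →ₗ[k] k} {κ κ' : Form k A} (h : IsFreeCumulant φ κ)
    (h1 : κ' 1 = 0) (h' : (momentCharacter φ).toLinearMap =
      counit k A + prec κ' (momentCharacter φ).toLinearMap) : κ' = κ :=
  prec_right_injective h1 h.1.1 (by simp) h' h.2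

theorem IsBooleanCumulant.eq {φ : A →ₗ[k] k} {β β' : Form k A} (h : IsBooleanCumulant φ β)
    (h1 : β' 1 = 0) (h' : (momentCharacter φ).toLinearMap =
      counit k A + succ (momentCharacter φ).toLinearMap β') : β' = β :=
  succ_left_injective h1 h.1.1 (by simp) h' h.2

theorem IsFreeCumulant.isMonotoneCumulant_magnus [CharZero k] {φ : A →ₗ[k] k} {κ : Form k A}
    (h : IsFreeCumulant φ κ) : IsMonotoneCumulant φ (magnus κ) := by
  refine ⟨h.1.magnus, ?_⟩
  have e := expConv_eq_prec h.1.magnus.1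
  rw [W_magnus h.1.1] at e
  rw [eq_expPrec h.1.1 e]
  exact eq_expPrec h.1.1 h.2

theorem IsMonotoneCumulant.W_eq [CharZero k] {φ : A →ₗ[k] k} {ρ κ : Form k A}
    (hρ : IsMonotoneCumulant φ ρ) (hκ : IsFreeCumulant φ κ) : W ρ = κ := by
  refine hκ.eq (W_apply_one hρ.1.1) ?_
  rw [hρ.2]
  exact expConv_eq_prec hρ.1.1

theorem IsMonotoneCumulant.neg_W_neg_eq [CharZero k] {φ : A →ₗ[k] k} {ρ β : Form k A}
    (hρ : IsMonotoneCumulant φ ρ) (hβ : IsBooleanCumulant φ β) : -W (-ρ) = β := by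
  refine hβ.eq (by simp [W_apply_one, hρ.1.1]) ?_
  rw [hρ.2]
  exact expConv_eq_succ hρ.1.1

end CumulantShuffle

end

open CumulantShuffle in
theorem mainTheorem1 {k : Type*} [Field k] [CharZero k] {A : Type*} [Ring A] [Algebra k A]
    (φ : A →ₗ[k] k) (hφ : φ 1 = 1) :
    -- all the series below converge, and `Ω'` and `W` are well-defined and mutually inverse
    (∀ f : Form k A, f 1 = 0 →
      HasLocalSum (expConvTerm f) (expConv f) ∧
      HasLocalSum (precPow f) (expPrec f) ∧
      HasLocalSum (succPow f) (expSucc f) ∧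
      HasLocalSum (WTerm f) (W f) ∧
      IsMagnus f (magnus f) ∧ (∀ ω, IsMagnus f ω → ω = magnus f) ∧
      W (magnus f) = f ∧ magnus (W f) = f) ∧
    -- each family of cumulants is given by exactly one infinitesimal character
    (∃! κ : Form k A, IsFreeCumulant φ κ) ∧
    (∃! β : Form k A, IsBooleanCumulant φ β) ∧
    (∃! ρ : Form k A, IsMonotoneCumulant φ ρ) ∧
    ∀ κ β ρ : Form k A,
      IsFreeCumulant φ κ → IsBooleanCumulant φ β → IsMonotoneCumulant φ ρ →
      ((momentCharacter φ).toLinearMap = expPrec κ ∧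
        (momentCharacter φ).toLinearMap = expConv (magnus κ) ∧
        (momentCharacter φ).toLinearMap = expSucc (-W (-magnus κ))) ∧
      ((momentCharacter φ).toLinearMap = expSucc β ∧
        (momentCharacter φ).toLinearMap = expConv (-magnus (-β)) ∧
        (momentCharacter φ).toLinearMap = expPrec (W (-magnus (-β)))) ∧
      ((momentCharacter φ).toLinearMap = expConv ρ ∧
        (momentCharacter φ).toLinearMap = expPrec (W ρ) ∧
        (momentCharacter φ).toLinearMap = expSucc (-W (-ρ))) ∧
      (ρ = magnus κ ∧ β = -W (-magnus κ)) ∧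
      (ρ = -magnus (-β) ∧ κ = W (-magnus (-β))) ∧
      (κ = W ρ ∧ β = -W (-ρ)) := by
  refine ⟨fun f hf => ⟨hasLocalSum_localSum (expConvTerm_mem hf),
    hasLocalSum_localSum (precPow_mem hf), hasLocalSum_localSum (succPow_mem hf),
    hasLocalSum_localSum (WTerm_mem' hf), isMagnus_magnus hf,
    fun ω hω => hω.unique hf (isMagnus_magnus hf), W_magnus hf, magnus_W hf⟩, ?_, ?_, ?_, ?_⟩
  · obtain ⟨κ, hκ⟩ := exists_isFreeCumulant φ
    exact ⟨κ, hκ, fun κ' h => hκ.eq h.1.1 h.2⟩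
  · obtain ⟨β, hβ⟩ := exists_isBooleanCumulant φ
    exact ⟨β, hβ, fun β' h => hβ.eq h.1.1 h.2⟩
  · obtain ⟨κ, hκ⟩ := exists_isFreeCumulant φ
    refine ⟨magnus κ, hκ.isMonotoneCumulant_magnus, fun ρ h => ?_⟩
    rw [← h.W_eq hκ, magnus_W h.1.1]
  · intro κ β ρ hκ hβ hρ
    have h1 : W ρ = κ := hρ.W_eq hκ
    have h2 : -W (-ρ) = β := hρ.neg_W_neg_eq hβ
    have h3 : magnus κ = ρ := by rw [← h1, magnus_W hρ.1.1]
    have h4 : -magnus (-β) = ρ := by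
      rw [← h2, neg_neg, magnus_W (by simp [hρ.1.1]), neg_neg]
    have e1 := eq_expPrec hκ.1.1 hκ.2
    have e2 := eq_expSucc hβ.1.1 hβ.2
    rw [h4, h3, h1, h2]
    exact ⟨⟨e1, hρ.2, e2⟩, ⟨e2, hρ.2, e1⟩, ⟨hρ.2, e1, e2⟩, ⟨rfl, rfl⟩, ⟨rfl, rfl⟩, rfl, rfl⟩
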